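/- Let $a>0$, $\mathbf v_1=a(\frac{\sqrt3}{2},\frac12)$, $\mathbf v_2=a(\frac{\sqrt3}{2},-\frac12)$, let $\Lambda=\mathbb Z\mathbf v_1\oplus\mathbb Z\mathbf v_2$ be the triangular lattice with fundamental cell $\Gamma=\{s\mathbf v_1+t\mathbf v_2: 0\le s,t<1\}$, and let $\mathbf k_1,\mathbf k_2$ be the dual basis, $\mathbf k_i\cdot\mathbf v_j=2\pi\delta_{ij}$; write $\xi_{\mathbf m}=m_1\mathbf k_1+m_2\mathbf k_2$ for $\mathbf m\in\mathbb Z^2$. Put $\mathbf y_1=\mathbf 0$ and $\mathbf y_2=\mathbf x_0=\frac23(\mathbf v_1+\mathbf v_2)$, so that $\Lambda+\{\mathbf 0,\mathbf x_0\}$ is a honeycomb lattice. For $\mathbf k\in\mathbb R^2$ let $L^2_{\mathbf k}(\Gamma)$ be the space of locally square-integrable $f$ on $\mathbb R^2$ with $f(\mathbf x+\mathbf v_j)=e^{i\mathbf k\cdot\mathbf v_j}f(\mathbf x)$, $j=1,2$, with the norm of $L^2(\Gamma)$, and let $\hat f(\mathbf m)=\frac1{\mathrm{area}(\Gamma)}\int_\Gamma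 f(\mathbf x)e^{-i(\xi_{\mathbf m}+\mathbf k)\cdot\mathbf x}\,d\mathbf x$. Let $-\Delta(\mathbf k)$ be the Floquet Laplacian on $L^2_{\mathbf k}(\Gamma)$, $\widehat{-\Delta(\mathbf k)\psi}(\mathbf m)=|\xi_{\mathbf m}+\mathbf k|^2\hat\psi(\mathbf m)$, with domain all $\psi$ for which the right-hand side is square-summable. For $\alpha\in(-\infty,\infty]$ let $-\Delta_{\alpha,\{\mathbf 0,\mathbf x_0\}}(\mathbf k)$ be the fiber operator with point scatterers of the same parameter $\alpha$ at $\mathbf 0$ and $\mathbf x_0$: $\psi$ lies in its domain and is mapped to $\eta$ if and only if $\psi,\eta\in L^2_{\mathbf k}(\Gamma)$ and there are $q_1,q_2\in\mathbb C$ such that $$|\xi_{\mathbf m}+\mathbf k|^2\hat\psi(\mathbf m)=\hat\eta(\mathbf m)+\frac1{\mathrm{area}(\Gamma)}\sum_{j=1}^2 q_je^{-i(\xi_{\mathbf m}+\mathbf k)\cdot\mathbf y_j}\qquad(\mathbf m\in\mathbb Z^2)$$ (that is, $-\Delta\psi=\eta+q_1\delta_{\mathbf y_1}+q_2\delta_{\mathbf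 y_2}$) and, for $j=1,2$, $$\lim_{r\to\infty}\Big[\sum_{|\xi_{\mathbf m}+\mathbf k|\le r}\hat\psi(\mathbf m)e^{i(\xi_{\mathbf m}+\mathbf k)\cdot\mathbf y_j}-\frac{\ln r}{2\pi}q_j\Big]=\alpha q_j\quad\text{if }\alpha<\infty,\qquad q_j=0\quad\text{if }\alpha=\infty .$$ In particular $\alpha=\infty$ gives $-\Delta(\mathbf k)$. Proposition. For every $\mathbf k\in\mathbb R^2$ (in particular for every $\mathbf k$ in the Brillouin zone) and every $\alpha\in(-\infty,\infty]$, the eigenvalues of $-\Delta_{\alpha,\{\mathbf 0,\mathbf x_0\}}(\mathbf k)$ and of $-\Delta(\mathbf k)$ are real, of finite multiplicity, and can be listed, repeated according to multiplicity, as $$\lambda_1(\mathbf k,\alpha)\le\lambda_2(\mathbf k,\alpha)\le\cdots\qquad\text{and}\qquad \lambda_1^\infty(\mathbf k)\le\lambda_2^\infty(\mathbf k)\le\cdots .$$ Moreover: 1. for every $j\ge1$ the function $\alpha\mapsto\lambda_j(\mathbf k,\alpha)$ is non-decreasing on $(-\infty,\infty]$; 2. $\lambda_j(\mathbf k,\alpha)\ge\lambda_1^\infty(\mathbf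 k)\ge0$ for all $j\ge3$ and all $\alpha\in(-\infty,\infty]$; 3. $\lambda_j(\mathbf k,\alpha)\to-\infty$ as $\alpha\to-\infty$ for $j=1,2$; 4. $\displaystyle\lim_{\alpha\to\infty}\lambda_j(\mathbf k,\alpha)=\lim_{\alpha\to-\infty}\lambda_{j+2}(\mathbf k,\alpha)=\lambda_j^\infty(\mathbf k)$ for all $j\ge1$. -/

import Mathlib

open Filter Topology MeasureTheory

noncomputable section

namespace PointScatterer

/-- The plane `ℝ²` with its Euclidean structure. -/
abbrev Plane : Type := EuclideanSpace ℝ (Fin 2)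

/-- The generator `v₁ = a (√3/2, 1/2)` of the triangular lattice `Λ = ℤ v₁ ⊕ ℤ v₂`. -/
def v₁ (a : ℝ) : Plane := !₂[a * (√3 / 2), a * (1 / 2)]

/-- The generator `v₂ = a (√3/2, -1/2)` of the triangular lattice `Λ = ℤ v₁ ⊕ ℤ v₂`. -/
def v₂ (a : ℝ) : Plane := !₂[a * (√3 / 2), -(a * (1 / 2))]

/-- The dual generator `k₁ = 4π/(a√3) (1/2, √3/2)`. -/
def k₁ (a : ℝ) : Plane :=
  !₂[4 * Real.pi / (a * √3) * (1 / 2), 4 * Real.pi / (a * √3) * (√3 / 2)]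

/-- The dual generator `k₂ = 4π/(a√3) (1/2, -√3/2)`. -/
def k₂ (a : ℝ) : Plane :=
  !₂[4 * Real.pi / (a * √3) * (1 / 2), -(4 * Real.pi / (a * √3) * (√3 / 2))]

/-- The dual lattice vector `ξ_m = m₁ k₁ + m₂ k₂`. -/
def dualVec (a : ℝ) (m : Fin 2 → ℤ) : Plane := (m 0 : ℝ) • k₁ a + (m 1 : ℝ) • k₂ a

/-- The two scatterers `y₁ = 0` and `y₂ = x₀ = (2/3)(v₁ + v₂)` in the fundamental domain;
`Λ + {0, x₀}` is the honeycomb lattice. -/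
def site (a : ℝ) : Fin 2 → Plane := ![0, (2 / 3 : ℝ) • (v₁ a + v₂ a)]

/-- The fundamental domain `Γ` of `Λ`, as the half-open cell spanned by `v₁`, `v₂`. -/
def cell (a : ℝ) : Set Plane :=
  {x | ∃ s ∈ Set.Ico (0 : ℝ) 1, ∃ t ∈ Set.Ico (0 : ℝ) 1, x = s • v₁ a + t • v₂ a}

/-- The Hilbert space `L²_k(Γ)`: a function on the plane with `f (x + v) = e^{i k·v} f x` for
`v ∈ Λ` is the same thing as its restriction to the cell `Γ`, and the norm is that of `L²(Γ)`.
The quasi-momentum `k` enters through the plane waves `wave a k m`, which are quasi-periodic. -/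
abbrev L2 (a : ℝ) : Type := Lp ℂ 2 (volume.restrict (cell a))

theorem inner_k_v (a : ℝ) (ha : 0 < a) :
    inner ℝ (k₁ a) (v₁ a) = 2 * Real.pi ∧ inner ℝ (k₁ a) (v₂ a) = 0 ∧
      inner ℝ (k₂ a) (v₁ a) = 0 ∧ inner ℝ (k₂ a) (v₂ a) = 2 * Real.pi := by
  have h3 : √3 ≠ 0 := by positivity
  have h4 : √3 ^ 2 = 3 := Real.sq_sqrt (by norm_num)
  refine ⟨?_, ?_, ?_, ?_⟩ <;>
    simp [k₁, k₂, v₁, v₂, PiLp.inner_apply, Fin.sum_univ_two] <;> field_simp <;> ring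

theorem finite_dual_ball (a : ℝ) (ha : 0 < a) (k : Plane) (r : ℝ) :
    {m : Fin 2 → ℤ | ‖dualVec a m + k‖ ≤ r}.Finite := by
  obtain ⟨h11, h12, h21, h22⟩ := inner_k_v a ha
  have hpi := Real.pi_gt_three
  have key : ∀ (v : Plane) (n : ℤ) (m : Fin 2 → ℤ), ‖dualVec a m + k‖ ≤ r →
      inner ℝ (dualVec a m) v = n * (2 * Real.pi) → |(n : ℝ)| ≤ (r + ‖k‖) * ‖v‖ := by
    intro v n m hm hn
    have h1 : inner ℝ (dualVec a m) v = inner ℝ (dualVec a m + k - k) v := by simp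
    have h2 : |inner ℝ (dualVec a m) v| ≤ (r + ‖k‖) * ‖v‖ := by
      rw [h1]
      refine (abs_real_inner_le_norm _ _).trans ?_
      gcongr
      exact (norm_sub_le _ _).trans (by gcongr)
    rw [hn, abs_mul, abs_of_pos (by positivity : 0 < 2 * Real.pi)] at h2
    nlinarith [abs_nonneg (n : ℝ)]
  set N : ℝ := max ((r + ‖k‖) * ‖v₁ a‖) ((r + ‖k‖) * ‖v₂ a‖) with hN
  have hfin : (Set.pi Set.univ (fun _ : Fin 2 => Set.Icc (-⌈N⌉) ⌈N⌉)).Finite :=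
    Set.Finite.pi' (fun _ => Set.finite_Icc _ _) |>.subset (by intro f hf i; exact hf i trivial)
  refine hfin.subset ?_
  intro m hm i _
  have hb : |(m i : ℝ)| ≤ N := by
    fin_cases i
    · refine (key (v₁ a) (m 0) m hm ?_).trans (le_max_left _ _)
      simp [dualVec, inner_add_left, real_inner_smul_left, h11, h21]
    · refine (key (v₂ a) (m 1) m hm ?_).trans (le_max_right _ _)
      simp [dualVec, inner_add_left, real_inner_smul_left, h12, h22]
  have hc : N ≤ ⌈N⌉ := Int.le_ceil N
  have := abs_le.1 (hb.trans hc)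
  constructor
  · exact_mod_cast this.1
  · exact_mod_cast this.2

theorem isBounded_cell (a : ℝ) : Bornology.IsBounded (cell a) := by
  refine (Metric.isBounded_closedBall (x := (0 : Plane)) (r := ‖v₁ a‖ + ‖v₂ a‖)).subset ?_
  rintro x ⟨s, hs, t, ht, rfl⟩
  rw [mem_closedBall_zero_iff]
  refine (norm_add_le _ _).trans ?_
  rw [norm_smul, norm_smul, Real.norm_of_nonneg hs.1, Real.norm_of_nonneg ht.1]
  exact add_le_add (mul_le_of_le_one_left (norm_nonneg _) hs.2.le)
    (mul_le_of_le_one_left (norm_nonneg _) ht.2.le)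

instance isFiniteMeasure_cell (a : ℝ) : IsFiniteMeasure (volume.restrict (cell a)) :=
  ⟨by rw [Measure.restrict_apply_univ]; exact (isBounded_cell a).measure_lt_top⟩

/-- The quasi-periodic plane wave `x ↦ e^{i (ξ_m + k)·x}`. -/
def planeWave (a : ℝ) (k : Plane) (m : Fin 2 → ℤ) (x : Plane) : ℂ :=
  Complex.exp (Complex.I * (inner ℝ (dualVec a m + k) x : ℝ))

theorem memLp_planeWave (a : ℝ) (k : Plane) (m : Fin 2 → ℤ) :
    MemLp (planeWave a k m) 2 (volume.restrict (cell a)) := by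
  refine MemLp.of_bound (C := 1) ?_ (Eventually.of_forall fun x => ?_)
  · refine Continuous.aestronglyMeasurable ?_
    unfold planeWave
    fun_prop
  · rw [planeWave, mul_comm, Complex.norm_exp_ofReal_mul_I]

/-- The plane wave as an element of `L²_k(Γ)`. -/
def wave (a : ℝ) (k : Plane) (m : Fin 2 → ℤ) : L2 a := (memLp_planeWave a k m).toLp

/-- The Fourier coefficient
`f̂(m) = area(Γ)⁻¹ ∫_Γ e^{-i (ξ_m + k)·x} f(x) dx`, so that
`f(x) = ∑_m f̂(m) e^{i (ξ_m + k)·x}` in `L²_k(Γ)`. -/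
def coeff (a : ℝ) (k : Plane) (m : Fin 2 → ℤ) (f : L2 a) : ℂ :=
  ((volume.real (cell a) : ℝ) : ℂ)⁻¹ * inner ℂ (wave a k m) f

/-- The value at `x` of `f` with momentum cutoff `r`:
`∑_{|ξ_m + k| ≤ r} f̂(m) e^{i (ξ_m + k)·x}` (a finite sum). -/
def cutoffValue (a : ℝ) (k : Plane) (r : ℝ) (f : L2 a) (x : Plane) : ℂ :=
  ∑ᶠ m ∈ {m : Fin 2 → ℤ | ‖dualVec a m + k‖ ≤ r}, coeff a k m f * planeWave a k m x

theorem coeff_add (a : ℝ) (k : Plane) (m : Fin 2 → ℤ) (f g : L2 a) :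
    coeff a k m (f + g) = coeff a k m f + coeff a k m g := by
  simp [coeff, inner_add_right, mul_add]

theorem coeff_smul (a : ℝ) (k : Plane) (m : Fin 2 → ℤ) (c : ℂ) (f : L2 a) :
    coeff a k m (c • f) = c * coeff a k m f := by
  simp only [coeff, inner_smul_right]; ring

theorem coeff_zero (a : ℝ) (k : Plane) (m : Fin 2 → ℤ) : coeff a k m 0 = 0 := by
  simp [coeff]

theorem cutoffValue_add (a : ℝ) (ha : 0 < a) (k : Plane) (r : ℝ) (f g : L2 a) (x : Plane) :
    cutoffValue a k r (f + g) x = cutoffValue a k r f x + cutoffValue a k r g x := by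
  simp only [cutoffValue, coeff_add, add_mul]
  exact finsum_mem_add_distrib (finite_dual_ball a ha k r)

theorem cutoffValue_smul (a : ℝ) (k : Plane) (r : ℝ) (c : ℂ) (f : L2 a)
    (x : Plane) : cutoffValue a k r (c • f) x = c * cutoffValue a k r f x := by
  simp only [cutoffValue, coeff_smul, mul_assoc]
  exact (mul_finsum_mem _ c).symm

/-- The graph of the Floquet Laplacian `-Δ(k)` with domain `H²_k(Γ)`, through Fourier series: the
pairs `(ψ, η)` in `L²_k(Γ)` with `η̂(m) = |ξ_m + k|² ψ̂(m)` for all `m`. -/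
def floquetLaplacian (a : ℝ) (k : Plane) : Submodule ℂ (L2 a × L2 a) where
  carrier := {p | ∀ m, coeff a k m p.2 = ((‖dualVec a m + k‖ ^ 2 : ℝ) : ℂ) * coeff a k m p.1}
  zero_mem' := by intro m; simp [coeff_zero]
  add_mem' := by
    intro p q hp hq m
    simp only [Prod.fst_add, Prod.snd_add, coeff_add, hp m, hq m, mul_add]
  smul_mem' := by
    intro c p hp m
    simp only [Prod.smul_fst, Prod.smul_snd, coeff_smul, hp m]; ring

/-- `IsPointAction a k α q ψ η`: the function `ψ` with charges `q = (q₁, q₂)` lies in the domain of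
the point-scatterer operator with parameters `α = (α₁, α₂) ∈ (-∞, ∞]²`, which maps it to `η`.

* Away from the scatterers the operator is the Laplacian:
  `-Δ ψ = η + ∑_j q_j δ_{y_j}` for the quasi-periodic delta functions
  `δ_{y_j}`, whose Fourier coefficients are `area(Γ)⁻¹ e^{-i (ξ_m + k)·y_j}`.
* The renormalized value of `ψ` at `y_j` is tied to the charge by
  `lim_{r → ∞} [∑_{|ξ_m + k| ≤ r} ψ̂(m) e^{i (ξ_m + k)·y_j} - (log r / 2π) q_j] = α_j q_j`,
  that is, `q_j` is the limit of the coupling `c_j(r) = (α_j + log r / 2π)⁻¹` times the cutoff value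
  of `ψ` at `y_j`. For `α_j = ∞` the charge vanishes.

For `λ` outside the spectrum of `-Δ(k)` this says
`ψ = φ + ∑_j q_j g_λ(· - y_j)` with `φ ∈ H²_k(Γ)`, `η - λ ψ = (-Δ(k) - λ) φ` and
`α_j q_j - ∑_l g_λ(y_j - y_l) q_l = φ(y_j)`, where
`g_λ(x) = area(Γ)⁻¹ lim_r [∑_{|ξ_m + k| ≤ r} e^{i (ξ_m + k)·x} / (|ξ_m + k|² - λ)]`, with
`log r / 2π` subtracted (after division by `area(Γ)`) if `x ∈ Λ`: the Krein resolvent formula. -/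
def IsPointAction (a : ℝ) (k : Plane) (α : Fin 2 → WithTop ℝ) (q : Fin 2 → ℂ)
    (ψ η : L2 a) : Prop :=
  (∀ m, ((‖dualVec a m + k‖ ^ 2 : ℝ) : ℂ) * coeff a k m ψ =
      coeff a k m η + ((volume.real (cell a) : ℝ) : ℂ)⁻¹ *
        ∑ j, q j * (starRingEnd ℂ) (planeWave a k m (site a j))) ∧
    ∀ j, (α j = ⊤ → q j = 0) ∧
      ∀ b : ℝ, α j = (b : WithTop ℝ) →
        Tendsto (fun r : ℝ => cutoffValue a k r ψ (site a j) -
          ((Real.log r / (2 * Real.pi) : ℝ) : ℂ) * q j) atTop (𝓝 ((b : ℂ) * q j))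

/-- The graph of the fiber operator `-Δ_{α,Y}(k)` on `L²_k(Γ)` with scatterers at
`Y = {0, x₀}` of parameters `α = (α₁, α₂) ∈ (-∞, ∞]²`. -/
def pointScatterer (a : ℝ) (ha : 0 < a) (k : Plane) (α : Fin 2 → WithTop ℝ) :
    Submodule ℂ (L2 a × L2 a) where
  carrier := {p | ∃ q : Fin 2 → ℂ, IsPointAction a k α q p.1 p.2}
  zero_mem' := by
    refine ⟨0, fun m => by simp [coeff_zero], fun j => ⟨fun _ => rfl, fun b _ => ?_⟩⟩
    simp [cutoffValue, coeff_zero]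
  add_mem' := by
    rintro p p' ⟨q, hq, hb⟩ ⟨q', hq', hb'⟩
    refine ⟨q + q', fun m => ?_, fun j => ⟨fun h => ?_, fun b h => ?_⟩⟩
    · simp only [Prod.fst_add, Prod.snd_add, coeff_add, mul_add, hq m, hq' m, Pi.add_apply,
        add_mul, Finset.sum_add_distrib]
      ring
    · simp [(hb j).1 h, (hb' j).1 h]
    · have := ((hb j).2 b h).add ((hb' j).2 b h)
      simp only [Prod.fst_add, Pi.add_apply, cutoffValue_add a ha, mul_add]
      refine this.congr fun r => ?_
      ring
  smul_mem' := by
    rintro c p ⟨q, hq, hb⟩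
    refine ⟨c • q, fun m => ?_, fun j => ⟨fun h => ?_, fun b h => ?_⟩⟩
    · simp only [Prod.smul_fst, Prod.smul_snd, coeff_smul, Pi.smul_apply, smul_eq_mul]
      rw [mul_left_comm, hq m]
      simp only [Fin.sum_univ_two]
      ring
    · simp [(hb j).1 h]
    · have := ((hb j).2 b h).const_mul c
      simp only [Prod.smul_fst, Pi.smul_apply, cutoffValue_smul a, smul_eq_mul]
      rw [mul_left_comm]
      refine this.congr fun r => ?_
      ring

/-- The eigenspace `{ψ | A ψ = μ ψ}` of the operator `A` with graph `G`. -/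
def eigenspace {H : Type*} [AddCommGroup H] [Module ℂ H] (G : Submodule ℂ (H × H)) (μ : ℂ) :
    Submodule ℂ H :=
  G.comap (LinearMap.prod LinearMap.id (μ • LinearMap.id))

/-- `lam 0 ≤ lam 1 ≤ …` are the eigenvalues of the operator with graph `G`, each repeated
according to its (finite) multiplicity: all eigenvalues are real, and every number `μ` occurs in
the sequence exactly `dim (eigenspace G μ)` times. -/
def IsEigenvalueSequence {H : Type*} [AddCommGroup H] [Module ℂ H] (G : Submodule ℂ (H × H))
    (lam : ℕ → ℝ) : Prop :=
  Monotone lam ∧ ∀ μ : ℂ, {j | (lam j : ℂ) = μ}.Finite ∧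
    FiniteDimensional ℂ (eigenspace G μ) ∧
    Module.finrank ℂ (eigenspace G μ) = {j | (lam j : ℂ) = μ}.ncard

end PointScatterer

end

noncomputable section

namespace PointScatterer

/-! ### Enumeration of eigenvalues -/

theorem exists_equiv_nat_monotone {ι : Type*} [Infinite ι] (l : ι → ℝ)
    (hl : ∀ μ, {i | l i ≤ μ}.Finite) : ∃ e : ℕ ≃ ι, Monotone (l ∘ e) := by
  have hc : Countable ι := by
    have h : (⋃ n : ℕ, {i | l i ≤ n}).Countable := Set.countable_iUnion fun n => (hl n).countable
    have h' : (⋃ n : ℕ, {i | l i ≤ n}) = Set.univ := by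
      ext i
      simpa using exists_nat_ge (l i)
    rw [h'] at h
    exact Set.countable_univ_iff.1 h
  obtain ⟨c, hcinj⟩ := hc.exists_injective_nat
  let f : ι → ℝ ×ₗ ℕ := fun i => toLex (l i, c i)
  have hf : Function.Injective f := fun i j h => hcinj (congrArg Prod.snd (toLex_inj.1 h))
  have hfl : ∀ i j, f i ≤ f j → l i ≤ l j := by
    intro i j h
    rcases (Prod.Lex.toLex_le_toLex).1 h with h | h
    · exact h.le
    · exact h.1.le
  have hfin : ∀ i, {j | f j < f i}.Finite := fun i => (hl (l i)).subset fun j hj => hfl j i hj.le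
  let r : ι → ℕ := fun i => {j | f j < f i}.ncard
  have hr : ∀ i j, f i < f j → r i < r j := by
    intro i j h
    refine Set.ncard_lt_ncard ?_ (hfin j)
    refine ⟨fun x hx => lt_trans hx h, fun hs => ?_⟩
    have : f i < f i := hs (show i ∈ {x | f x < f j} from h)
    exact lt_irrefl _ this
  have hrinj : Function.Injective r := by
    intro i j h
    by_contra hne
    rcases lt_or_gt_of_ne (hf.ne hne) with h' | h'
    · exact (hr _ _ h').ne h
    · exact (hr _ _ h').ne' h
  have : Infinite (Set.range r) := (Set.infinite_range_of_injective hrinj).to_subtype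
  classical
  let o := Nat.Subtype.orderIsoOfNat (Set.range r)
  let e : ℕ ≃ ι := o.toEquiv.trans (Equiv.ofInjective r hrinj).symm
  have he : ∀ n, r (e n) = o n := fun n => Equiv.apply_ofInjective_symm hrinj (o n)
  refine ⟨e, fun n m hnm => hfl _ _ ?_⟩
  by_contra hlt
  have h1 := hr _ _ (not_le.1 hlt)
  rw [he, he] at h1
  exact absurd (o.monotone hnm) (not_le.2 h1)

theorem IsEigenvalueSequence.unique {H : Type*} [AddCommGroup H] [Module ℂ H]
    {G : Submodule ℂ (H × H)} {lam lam' : ℕ → ℝ} (h : IsEigenvalueSequence G lam)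
    (h' : IsEigenvalueSequence G lam') : lam = lam' := by
  have key : ∀ {l l' : ℕ → ℝ}, IsEigenvalueSequence G l → IsEigenvalueSequence G l' →
      ∀ j, (∀ i < j, l i = l' i) → l' j ≤ l j := by
    intro l l' hl hl' j hij
    by_contra hlt
    push Not at hlt
    have hc : {i | (l i : ℂ) = (l j : ℝ)}.ncard = {i | (l' i : ℂ) = (l j : ℝ)}.ncard := by
      rw [← (hl.2 _).2.2, ← (hl'.2 _).2.2]
    refine (Set.ncard_lt_ncard ?_ (hl.2 (l j : ℝ)).1).ne' hc
    have hsub : ∀ i, (l' i : ℂ) = (l j : ℝ) → i < j := by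
      intro i hi
      have hi' : l' i = l j := by exact_mod_cast hi
      by_contra hji
      have := hl'.1 (not_lt.1 hji)
      linarith
    refine ⟨fun i hi => ?_, fun hs => ?_⟩
    · have := hsub i hi
      simp only [Set.mem_ofPred_eq] at hi ⊢
      rw [hij i this, hi]
    · exact lt_irrefl _ (hsub j (hs rfl))
  funext j
  induction j using Nat.strong_induction_on with
  | _ j ih => exact le_antisymm (key h' h j fun i hi => (ih i hi).symm) (key h h' j ih)

variable {H : Type*} [NormedAddCommGroup H] [InnerProductSpace ℂ H]

theorem isEigenvalueSequence_of_hilbertBasis {G : Submodule ℂ (H × H)}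
    (hG : ∀ p ∈ G, ∀ p' ∈ G, inner ℂ p.2 p'.1 = inner ℂ p.1 p'.2) (e : HilbertBasis ℕ ℂ H)
    {lam : ℕ → ℝ} (hmono : Monotone lam) (hfin : ∀ μ, {j | lam j ≤ μ}.Finite)
    (he : ∀ j, (e j, (lam j : ℂ) • e j) ∈ G) : IsEigenvalueSequence G lam := by
  refine ⟨hmono, fun μ => ?_⟩
  have hf : {j | (lam j : ℂ) = μ}.Finite := by
    refine (hfin μ.re).subset fun j hj => ?_
    have := congrArg Complex.re (show (lam j : ℂ) = μ from hj)
    simp only [Complex.ofReal_re] at this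
    exact this.le
  have hspan : eigenspace G μ = Submodule.span ℂ (Set.range fun j : hf.toFinset => e j) := by
    apply le_antisymm
    · intro ψ hψ
      have hψ' : (ψ, μ • ψ) ∈ G := hψ
      have h0 : ∀ j, (lam j : ℂ) ≠ μ → inner ℂ (e j) ψ = 0 := by
        intro j hj
        have := hG _ (he j) _ hψ'
        simp only [inner_smul_left, inner_smul_right, Complex.conj_ofReal] at this
        have h1 : ((lam j : ℂ) - μ) * inner ℂ (e j) ψ = 0 := by rw [sub_mul, this, sub_self]
        exact (mul_eq_zero.1 h1).resolve_left (sub_ne_zero.2 hj)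
      have hs := e.hasSum_repr ψ
      have hs' : ψ = ∑ j ∈ hf.toFinset, e.repr ψ j • e j := by
        refine hs.unique (hasSum_sum_of_ne_finset_zero fun j hj => ?_)
        rw [e.repr_apply_apply, h0 j (by simpa using hj), zero_smul]
      rw [hs']
      refine Submodule.sum_mem _ fun j hj => Submodule.smul_mem _ _ ?_
      exact Submodule.subset_span ⟨⟨j, hj⟩, rfl⟩
    · rw [Submodule.span_le]
      rintro _ ⟨⟨j, hj⟩, rfl⟩
      have hj' : (lam j : ℂ) = μ := by simpa using hj
      change (e j, μ • e j) ∈ G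
      rw [← hj']
      exact he j
  refine ⟨hf, ?_, ?_⟩
  · rw [hspan]
    exact FiniteDimensional.span_of_finite ℂ (Set.finite_range _)
  · rw [hspan, finrank_span_eq_card, Fintype.card_coe, Set.ncard_eq_toFinset_card _ hf]
    exact e.orthonormal.linearIndependent.comp _ Subtype.val_injective

/-! ### Variational characterization of eigenvalues -/

variable {W : Type*} [AddCommGroup W] [Module ℂ W] {ι : Type*}

/-- `u i` are eigenvectors of the form `h` on `W₀` relative to `‖J ·‖²`, with eigenvalues `l i`,
whose images under `J` are the Hilbert basis `e`. -/
structure FormBasis (h : W →ₗ⋆[ℂ] W →ₗ[ℂ] ℂ) (J : W →ₗ[ℂ] H) (W₀ : Submodule ℂ W)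
    (e : HilbertBasis ι ℂ H) (u : ι → W) (l : ι → ℝ) : Prop where
  mem : ∀ i, u i ∈ W₀
  map : ∀ i, J (u i) = e i
  form : ∀ i, ∀ w ∈ W₀, h (u i) w = l i * inner ℂ (e i) (J w)

/-- The form `h + c ⟨J ·, J ·⟩`. -/
def shiftForm (h : W →ₗ⋆[ℂ] W →ₗ[ℂ] ℂ) (J : W →ₗ[ℂ] H) (c : ℝ) : W →ₗ⋆[ℂ] W →ₗ[ℂ] ℂ :=
  LinearMap.mk₂'ₛₗ (starRingEnd ℂ) (RingHom.id ℂ) (fun w w' => h w w' + c * inner ℂ (J w) (J w'))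
    (fun w w' w'' => by simp; ring) (fun a w w' => by simp; ring)
    (fun w w' w'' => by simp; ring) (fun a w w' => by simp; ring)

theorem shiftForm_apply (h : W →ₗ⋆[ℂ] W →ₗ[ℂ] ℂ) (J : W →ₗ[ℂ] H) (c : ℝ) (w w' : W) :
    shiftForm h J c w w' = h w w' + c * inner ℂ (J w) (J w') := rfl

theorem re_shiftForm_self (h : W →ₗ⋆[ℂ] W →ₗ[ℂ] ℂ) (J : W →ₗ[ℂ] H) (c : ℝ) (w : W) :
    (shiftForm h J c w w).re = (h w w).re + c * ‖J w‖ ^ 2 := by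
  rw [shiftForm_apply, inner_self_eq_norm_sq_to_K]
  simp [← Complex.ofReal_pow]

variable {h : W →ₗ⋆[ℂ] W →ₗ[ℂ] ℂ} {J : W →ₗ[ℂ] H} {W₀ : Submodule ℂ W}
  {e : HilbertBasis ι ℂ H} {u : ι → W} {l : ι → ℝ}

theorem FormBasis.shift (hb : FormBasis h J W₀ e u l) (c : ℝ) :
    FormBasis (shiftForm h J c) J W₀ e u (fun i => l i + c) where
  mem := hb.mem
  map := hb.map
  form i w hw := by
    rw [shiftForm_apply, hb.form i w hw, hb.map]
    push_cast
    ring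

theorem HilbertBasis.tendsto_sum_norm_sq (e : HilbertBasis ι ℂ H) (x : H) :
    HasSum (fun i => ‖inner ℂ (e i) x‖ ^ 2) (‖x‖ ^ 2) := by
  have h := e.hasSum_inner_mul_inner x x
  have h' := Complex.hasSum_re h
  rw [show (inner ℂ x x).re = ‖x‖ ^ 2 from by
    rw [inner_self_eq_norm_sq_to_K]; simp [← Complex.ofReal_pow]] at h'
  convert h' using 2 with i
  rw [← inner_conj_symm x (e i), ← Complex.normSq_eq_conj_mul_self, Complex.ofReal_re,
    Complex.normSq_eq_norm_sq]

theorem FormBasis.map_sum (hb : FormBasis h J W₀ e u l) (F : Finset ι) (a : ι → ℂ) :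
    J (∑ i ∈ F, a i • u i) = ∑ i ∈ F, a i • e i := by
  simp [hb.map]

theorem FormBasis.norm_sq_map_sum (hb : FormBasis h J W₀ e u l) (F : Finset ι) (a : ι → ℂ) :
    ‖J (∑ i ∈ F, a i • u i)‖ ^ 2 = ∑ i ∈ F, ‖a i‖ ^ 2 := by
  rw [hb.map_sum]
  have := e.orthonormal.inner_sum a a F
  rw [inner_self_eq_norm_sq_to_K] at this
  have h2 := congrArg Complex.re this
  simp only [Complex.re_sum, ← Complex.normSq_eq_conj_mul_self, Complex.ofReal_re,
    Complex.normSq_eq_norm_sq] at h2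
  rw [← h2]
  simp [← Complex.ofReal_pow]

theorem FormBasis.form_sum (hb : FormBasis h J W₀ e u l) (F : Finset ι) (a : ι → ℂ) {w : W}
    (hw : w ∈ W₀) : h (∑ i ∈ F, a i • u i) w =
      ∑ i ∈ F, (l i : ℂ) * (starRingEnd ℂ (a i) * inner ℂ (e i) (J w)) := by
  rw [_root_.map_sum, LinearMap.sum_apply]
  refine Finset.sum_congr rfl fun i _ => ?_
  rw [LinearMap.map_smulₛₗ, LinearMap.smul_apply, hb.form i w hw, smul_eq_mul]
  ring

theorem FormBasis.form_sum_self (hb : FormBasis h J W₀ e u l) (F : Finset ι) (a : ι → ℂ) :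
    h (∑ i ∈ F, a i • u i) (∑ i ∈ F, a i • u i) = ((∑ i ∈ F, l i * ‖a i‖ ^ 2 : ℝ) : ℂ) := by
  rw [hb.form_sum F a (Submodule.sum_mem _ fun i _ => Submodule.smul_mem _ _ (hb.mem i)),
    Complex.ofReal_sum]
  refine Finset.sum_congr rfl fun i hi => ?_
  rw [hb.map_sum, e.orthonormal.inner_right_sum a hi, ← Complex.normSq_eq_conj_mul_self,
    Complex.normSq_eq_norm_sq, Complex.ofReal_mul]

theorem FormBasis.sum_le (hb : FormBasis h J W₀ e u l)
    (hherm : ∀ w w', h w w' = starRingEnd ℂ (h w' w)) (hpos : ∀ w, 0 ≤ (h w w).re)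
    {w : W} (hw : w ∈ W₀) (F : Finset ι) :
    ∑ i ∈ F, l i * ‖inner ℂ (e i) (J w)‖ ^ 2 ≤ (h w w).re := by
  set a : ι → ℂ := fun i => inner ℂ (e i) (J w) with ha
  set v := ∑ i ∈ F, a i • u i with hv
  have h1 : h v w = ((∑ i ∈ F, l i * ‖a i‖ ^ 2 : ℝ) : ℂ) := by
    rw [hv, hb.form_sum F a hw, Complex.ofReal_sum]
    refine Finset.sum_congr rfl fun i _ => ?_
    rw [Complex.ofReal_mul, ← Complex.normSq_eq_norm_sq, Complex.normSq_eq_conj_mul_self]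
  have h2 := hpos (w - v)
  have h3 : h (w - v) (w - v) = h w w - h v w - h w v + h v v := by
    simp only [map_sub, LinearMap.sub_apply]
    ring
  rw [h3, hherm w v, h1, hb.form_sum_self, Complex.conj_ofReal] at h2
  simp only [Complex.add_re, Complex.sub_re, Complex.ofReal_re] at h2
  linarith

theorem FormBasis.le_of_finrank_lt {e : HilbertBasis ℕ ℂ H} {u : ℕ → W} {l : ℕ → ℝ}
    (hb : FormBasis h J W₀ e u l) (hl : Monotone l)
    (hherm : ∀ w w', h w w' = starRingEnd ℂ (h w' w)) {c : ℝ}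
    (hpos : ∀ w, 0 ≤ (h w w).re + c * ‖J w‖ ^ 2) {V : Submodule ℂ W} (hV : V ≤ W₀) {j : ℕ}
    (hj : j < Module.finrank ℂ V) (hJ : ∀ v ∈ V, J v = 0 → v = 0) {s : ℝ}
    (hs : ∀ v ∈ V, (h v v).re ≤ s * ‖J v‖ ^ 2) : l j ≤ s := by
  have hfd : FiniteDimensional ℂ V := FiniteDimensional.of_finrank_pos (by omega)
  let g : V →ₗ[ℂ] (Fin j → ℂ) :=
    LinearMap.pi fun i => ((innerSL ℂ (e i)).toLinearMap ∘ₗ J) ∘ₗ V.subtype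
  have hker : LinearMap.ker g ≠ ⊥ := LinearMap.ker_ne_bot_of_finrank_lt (by simpa using hj)
  obtain ⟨⟨v, hvV⟩, hvk, hv0⟩ := Submodule.exists_mem_ne_zero_of_ne_bot hker
  have hv0' : v ≠ 0 := fun h => hv0 (Subtype.ext h)
  have hz : ∀ i < j, inner ℂ (e i) (J v) = 0 := by
    intro i hi
    have := congrFun (LinearMap.mem_ker.1 hvk) ⟨i, hi⟩
    simpa [g] using this
  have hJv : 0 < ‖J v‖ ^ 2 := by
    have : J v ≠ 0 := fun h => hv0' (hJ v hvV h)
    positivity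
  have hb' := hb.shift c
  have hherm' : ∀ w w', shiftForm h J c w w' = starRingEnd ℂ (shiftForm h J c w' w) := by
    intro w w'
    rw [shiftForm_apply, shiftForm_apply, map_add, ← hherm, map_mul, Complex.conj_ofReal,
      inner_conj_symm]
  have hpos' : ∀ w, 0 ≤ (shiftForm h J c w w).re := by
    intro w
    rw [re_shiftForm_self]
    exact hpos w
  have hle : (l j + c) * ‖J v‖ ^ 2 ≤ (shiftForm h J c v v).re := by
    have hsum := (HilbertBasis.tendsto_sum_norm_sq e (J v)).mul_left (l j + c)
    refine hasSum_le_of_sum_le hsum fun F => ?_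
    refine le_trans (Finset.sum_le_sum fun i _ => ?_) (hb'.sum_le hherm' hpos' (hV hvV) F)
    rcases lt_or_ge i j with hi | hi
    · simp [hz i hi]
    · gcongr
      exact hl hi
  rw [re_shiftForm_self] at hle
  have := hs v hvV
  by_contra hlt
  push Not at hlt
  nlinarith

theorem FormBasis.linearIndependent (hb : FormBasis h J W₀ e u l) : LinearIndependent ℂ u := by
  refine LinearIndependent.of_comp J ?_
  rw [show J ∘ u = e from funext hb.map]
  exact e.orthonormal.linearIndependent

theorem FormBasis.finrank_span (hb : FormBasis h J W₀ e u l) (F : Finset ι) :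
    Module.finrank ℂ (Submodule.span ℂ (u '' F)) = F.card := by
  classical
  rw [← Finset.coe_image, finrank_span_finset_eq_card, Finset.card_image_of_injective]
  · exact hb.linearIndependent.injective
  · rw [Finset.coe_image]
    exact (hb.linearIndependent.linearIndepOn_id).mono (Set.image_subset_range _ _)

theorem FormBasis.span_le (hb : FormBasis h J W₀ e u l) (F : Finset ι) :
    Submodule.span ℂ (u '' F) ≤ W₀ := by
  rw [Submodule.span_le]
  rintro _ ⟨i, _, rfl⟩
  exact hb.mem i

theorem FormBasis.exists_eq_sum (_hb : FormBasis h J W₀ e u l) {F : Finset ι} {v : W}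
    (hv : v ∈ Submodule.span ℂ (u '' F)) : ∃ a : ι → ℂ, v = ∑ i ∈ F, a i • u i := by
  classical
  obtain ⟨a, rfl⟩ := (Submodule.mem_span_image_finset_iff_exists_fun ℂ).1 hv
  refine ⟨fun i => if hi : i ∈ F then a ⟨i, hi⟩ else 0, ?_⟩
  rw [← Finset.sum_coe_sort F]
  exact Finset.sum_congr rfl fun i _ => by simp

theorem FormBasis.re_form_le (hb : FormBasis h J W₀ e u l) {F : Finset ι} {s : ℝ}
    (hF : ∀ i ∈ F, l i ≤ s) {v : W} (hv : v ∈ Submodule.span ℂ (u '' F)) :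
    (h v v).re ≤ s * ‖J v‖ ^ 2 := by
  obtain ⟨a, rfl⟩ := hb.exists_eq_sum hv
  rw [hb.form_sum_self, Complex.ofReal_re, hb.norm_sq_map_sum, Finset.mul_sum]
  exact Finset.sum_le_sum fun i hi => mul_le_mul_of_nonneg_right (hF i hi) (by positivity)

/-! ### Eigenbases of compact symmetric operators -/

theorem exists_hilbertBasis_of_isCompactOperator [CompleteSpace H] {T : H →L[ℂ] H}
    (hT : IsCompactOperator T) (hT' : T.IsSymmetric) (hinj : Function.Injective T) :
    ∃ (ι : Type) (e : HilbertBasis ι ℂ H) (τ : ι → ℝ),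
      ∀ i, T (e i) = (τ i : ℂ) • e i ∧ τ i ≠ 0 := by
  have hbot : Module.End.eigenspace (T : Module.End ℂ H) 0 = ⊥ := by
    rw [Module.End.eigenspace_zero]
    exact LinearMap.ker_eq_bot.2 hinj
  have hfd : ∀ μ, FiniteDimensional ℂ (Module.End.eigenspace (T : Module.End ℂ H) μ) := by
    intro μ
    rcases eq_or_ne μ 0 with rfl | hμ
    · rw [hbot]
      infer_instance
    · exact ContinuousLinearMap.finite_dimensional_eigenspace hT μ hμ
  let b := fun μ => stdOrthonormalBasis ℂ (Module.End.eigenspace (T : Module.End ℂ H) μ)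
  have hort := hT'.orthogonalFamily_eigenspaces.orthonormal_sigma_orthonormal
    fun μ => (b μ).orthonormal
  have hspan : (Submodule.span ℂ (Set.range fun a : Σ μ : ℂ, Fin (Module.finrank ℂ
      (Module.End.eigenspace (T : Module.End ℂ H) μ)) =>
        (Module.End.eigenspace (T : Module.End ℂ H) a.1).subtypeₗᵢ (b a.1 a.2)))ᗮ = ⊥ := by
    rw [eq_bot_iff, ← ContinuousLinearMap.orthogonalComplement_iSup_eigenspaces_eq_bot hT hT']
    refine Submodule.orthogonal_le (iSup_le fun μ => ?_)
    intro x hx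
    have := (b μ).sum_repr ⟨x, hx⟩
    have h2 := congrArg Subtype.val this
    rw [← show _ = x from h2, Submodule.coe_sum]
    refine Submodule.sum_mem _ fun i _ => Submodule.smul_mem _ _ ?_
    exact Submodule.subset_span ⟨⟨μ, i⟩, rfl⟩
  let e := HilbertBasis.mkOfOrthogonalEqBot hort hspan
  have he : ∀ i, e i = (b i.1 i.2 : H) := fun i =>
    congrFun (HilbertBasis.coe_mkOfOrthogonalEqBot hort hspan) i
  have hTe : ∀ i, T (e i) = i.1 • e i := by
    intro i
    rw [he]
    exact Module.End.mem_eigenspace_iff.1 (b i.1 i.2).2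
  have he0 : ∀ i, e i ≠ 0 := fun i => e.orthonormal.ne_zero i
  have hreal : ∀ i : (Σ μ : ℂ, Fin (Module.finrank ℂ
      (Module.End.eigenspace (T : Module.End ℂ H) μ))), ((i.1.re : ℝ) : ℂ) = i.1 :=
    fun i => Complex.conj_eq_iff_re.1 <| by
    exact hT'.conj_eigenvalue_eq_self (Module.End.hasEigenvalue_of_hasEigenvector
      ⟨Module.End.mem_eigenspace_iff.2 (hTe i), he0 i⟩)
  refine ⟨_, e, fun i => i.1.re, fun i => ⟨by rw [hreal, hTe], fun h0 => he0 i ?_⟩⟩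
  apply hinj
  rw [hTe, ← hreal, show i.1.re = 0 from h0, map_zero, Complex.ofReal_zero, zero_smul]

theorem isCompactOperator_smulRight {E F : Type*} [NormedAddCommGroup E] [NormedSpace ℂ E]
    [NormedAddCommGroup F] [NormedSpace ℂ F] (φ : E →L[ℂ] ℂ) (y : F) :
    IsCompactOperator (φ.smulRight y) :=
  (isCompactOperator_of_locallyCompactSpace_rng
    ((ContinuousLinearMap.id ℂ ℂ).smulRight y)).comp_clm φ

theorem exists_isCompactOperator_diagonal [CompleteSpace H] (b : HilbertBasis ι ℂ H) (d : ι → ℝ)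
    (hd : Tendsto d cofinite (𝓝 0)) :
    ∃ T : H →L[ℂ] H, IsCompactOperator T ∧ ∀ i x, inner ℂ (b i) (T x) = d i * inner ℂ (b i) x := by
  classical
  let P : ι → H →L[ℂ] H := fun i => (d i : ℂ) • (innerSL ℂ (b i)).smulRight (b i)
  have hP : ∀ i x, P i x = ((d i : ℂ) * inner ℂ (b i) x) • b i := by
    intro i x
    change (d i : ℂ) • (inner ℂ (b i) x • b i) = _
    rw [smul_smul]
  have hsum : Summable P := by
    rw [summable_iff_vanishing_norm]
    intro ε hε
    have hfin : {i | ¬ |d i| < ε / 2}.Finite := by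
      have := (Metric.tendsto_nhds.1 hd) (ε / 2) (by positivity)
      simpa [dist_eq_norm] using this
    refine ⟨hfin.toFinset, fun t ht => ?_⟩
    refine lt_of_le_of_lt (ContinuousLinearMap.opNorm_le_bound _ (by positivity) fun x => ?_)
      (half_lt_self hε)
    rw [_root_.sum_apply, Finset.sum_congr rfl fun i _ => hP i x]
    refine le_of_sq_le_sq ?_ (by positivity)
    have h1 := b.orthonormal.inner_sum (fun i => (d i : ℂ) * inner ℂ (b i) x)
      (fun i => (d i : ℂ) * inner ℂ (b i) x) t
    rw [inner_self_eq_norm_sq_to_K] at h1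
    have h2 := congrArg Complex.re h1
    simp only [Complex.re_sum, ← Complex.normSq_eq_conj_mul_self, Complex.ofReal_re,
      Complex.normSq_eq_norm_sq] at h2
    have h3 : ‖∑ i ∈ t, ((d i : ℂ) * inner ℂ (b i) x) • b i‖ ^ 2 =
        ∑ i ∈ t, ‖(d i : ℂ) * inner ℂ (b i) x‖ ^ 2 := by
      rw [← h2]
      simp [← Complex.ofReal_pow]
    rw [h3, mul_pow]
    have h4 : ∑ i ∈ t, ‖inner ℂ (b i) x‖ ^ 2 ≤ ‖x‖ ^ 2 := b.orthonormal.sum_inner_products_le x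
    refine le_trans ?_ (mul_le_mul_of_nonneg_left h4 (by positivity))
    rw [Finset.mul_sum]
    refine Finset.sum_le_sum fun i hi => ?_
    rw [norm_mul, mul_pow]
    have h5 : |d i| < ε / 2 := by
      by_contra hn
      exact Finset.disjoint_left.1 ht hi (hfin.mem_toFinset.2 hn)
    have h6 : ‖(d i : ℂ)‖ ≤ ε / 2 := by
      rw [Complex.norm_real]
      exact h5.le
    gcongr
  refine ⟨∑' i, P i, ?_, fun i x => ?_⟩
  · refine isCompactOperator_of_tendsto hsum.hasSum (Eventually.of_forall fun F => ?_)
    refine Finset.sum_induction P (fun T => IsCompactOperator T) (fun S T hS hT => hS.add hT)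
      isCompactOperator_zero fun i _ => ?_
    exact (isCompactOperator_smulRight (innerSL ℂ (b i)) (b i)).smul (d i : ℂ)
  · have h1 := (hsum.hasSum.mapL (ContinuousLinearMap.apply ℂ H x)).mapL (innerSL ℂ (b i))
    have h2 : ∀ j, innerSL ℂ (b i) (ContinuousLinearMap.apply ℂ H x (P j)) =
        if j = i then (d i : ℂ) * inner ℂ (b i) x else 0 := by
      intro j
      change inner ℂ (b i) (P j x) = _
      rw [hP, inner_smul_right, orthonormal_iff_ite.1 b.orthonormal]
      by_cases hij : i = j
      · subst hij; simp
      · simp [hij, Ne.symm hij]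
    simp only [h2] at h1
    exact h1.unique (hasSum_ite_eq i _)

/-! ### Lattices in the plane -/

/-- The linear map `(s, t) ↦ s w₁ + t w₂`. -/
def latticeMap (w₁ w₂ : Plane) : (Fin 2 → ℝ) →ₗ[ℝ] Plane where
  toFun s := s 0 • w₁ + s 1 • w₂
  map_add' s t := by simp only [Pi.add_apply, add_smul]; abel
  map_smul' c s := by simp [smul_smul]

theorem latticeMap_apply (w₁ w₂ : Plane) (s : Fin 2 → ℝ) :
    latticeMap w₁ w₂ s = s 0 • w₁ + s 1 • w₂ := rfl

/-- The oriented area of the parallelogram spanned by `w₁`, `w₂`. -/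
def latticeDet (w₁ w₂ : Plane) : ℝ := w₁ 0 * w₂ 1 - w₂ 0 * w₁ 1

theorem continuous_latticeMap (w₁ w₂ : Plane) : Continuous (latticeMap w₁ w₂) :=
  LinearMap.continuous_of_finiteDimensional _

theorem latticeMap_eq (w₁ w₂ : Plane) :
    (latticeMap w₁ w₂ : (Fin 2 → ℝ) → Plane) = WithLp.toLp 2 ∘
      Matrix.toLin' !![w₁ 0, w₂ 0; w₁ 1, w₂ 1] := by
  funext s
  ext i
  fin_cases i <;> simp [latticeMap, Matrix.toLin'_apply, dotProduct,
    Fin.sum_univ_two] <;> ring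

theorem det_toLin' (w₁ w₂ : Plane) :
    LinearMap.det (Matrix.toLin' !![w₁ 0, w₂ 0; w₁ 1, w₂ 1]) = latticeDet w₁ w₂ := by
  rw [LinearMap.det_toLin', Matrix.det_fin_two_of, latticeDet]

theorem injective_latticeMap {w₁ w₂ : Plane} (hD : latticeDet w₁ w₂ ≠ 0) :
    Function.Injective (latticeMap w₁ w₂) := by
  rw [latticeMap_eq]
  refine (WithLp.toLp_injective 2).comp ?_
  have h : LinearMap.det (Matrix.toLin' !![w₁ 0, w₂ 0; w₁ 1, w₂ 1]) ≠ 0 := by rwa [det_toLin']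
  exact (LinearMap.equivOfDetNeZero _ h).injective

theorem map_latticeMap {w₁ w₂ : Plane} (hD : latticeDet w₁ w₂ ≠ 0) :
    (volume : Measure Plane) =
      ENNReal.ofReal |latticeDet w₁ w₂| • Measure.map (latticeMap w₁ w₂) volume := by
  have h1 : Measure.map (latticeMap w₁ w₂) volume =
      Measure.map (WithLp.toLp 2) (Measure.map
        (Matrix.toLin' !![w₁ 0, w₂ 0; w₁ 1, w₂ 1]) volume) := by
    rw [Measure.map_map (WithLp.measurable_toLp _ _)
      (LinearMap.continuous_of_finiteDimensional _).measurable, latticeMap_eq]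
  rw [h1, Real.map_linearMap_volume_pi_eq_smul_volume_pi (by rwa [det_toLin']), det_toLin',
    Measure.map_smul, (PiLp.volume_preserving_toLp (Fin 2)).map_eq, smul_smul,
    ← ENNReal.ofReal_mul (abs_nonneg _), abs_inv, mul_inv_cancel₀ (abs_ne_zero.2 hD)]
  simp

theorem latticeDet_v (a : ℝ) : latticeDet (v₁ a) (v₂ a) = -(a ^ 2 * √3 / 2) := by
  simp [latticeDet, v₁, v₂]
  ring

theorem latticeDet_k (a : ℝ) (ha : 0 < a) :
    latticeDet (k₁ a) (k₂ a) = -(4 * Real.pi ^ 2 / (a ^ 2 * √3 / 2)) := by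
  simp [latticeDet, k₁, k₂]
  field_simp
  ring

/-! ### Fourier series in `L²(Γ)` -/

/-- The unit square `(0, 1]²`. -/
def unitBox : Set (Fin 2 → ℝ) :=
  {s | ∀ i, s i ∈ Set.Ioc ((0 : Fin 2 → ℝ) i) ((0 : Fin 2 → ℝ) i + 1)}

theorem preimage_cell (a : ℝ) (ha : 0 < a) : latticeMap (v₁ a) (v₂ a) ⁻¹' cell a =
    Set.pi Set.univ fun _ => Set.Ico 0 1 := by
  have hinj : Function.Injective (latticeMap (v₁ a) (v₂ a)) := by
    refine injective_latticeMap ?_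
    rw [latticeDet_v]
    have : 0 < a ^ 2 * √3 / 2 := by positivity
    linarith
  ext s
  constructor
  · rintro ⟨x, hx, y, hy, h⟩
    have h' : latticeMap (v₁ a) (v₂ a) s = latticeMap (v₁ a) (v₂ a) ![x, y] := by
      rw [h, latticeMap_apply]
      simp
    rw [hinj h']
    intro i _
    fin_cases i
    · exact hx
    · exact hy
  · intro h
    exact ⟨s 0, h 0 trivial, s 1, h 1 trivial, rfl⟩

theorem cell_eq_image (a : ℝ) : cell a =
    latticeMap (v₁ a) (v₂ a) '' Set.pi Set.univ fun _ => Set.Ico 0 1 := by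
  ext x
  constructor
  · rintro ⟨s, hs, t, ht, rfl⟩
    refine ⟨![s, t], fun i _ => ?_, by simp [latticeMap_apply]⟩
    fin_cases i
    · exact hs
    · exact ht
  · rintro ⟨s, h, rfl⟩
    exact ⟨s 0, h 0 trivial, s 1, h 1 trivial, rfl⟩

theorem measurableSet_cell (a : ℝ) (ha : 0 < a) : MeasurableSet (cell a) := by
  rw [cell_eq_image]
  refine (MeasurableSet.univ_pi fun _ => measurableSet_Ico).image_of_continuousOn_injOn
    (continuous_latticeMap _ _).continuousOn (Function.Injective.injOn ?_)
  refine injective_latticeMap ?_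
  rw [latticeDet_v]
  have : 0 < a ^ 2 * √3 / 2 := by positivity
  linarith

theorem restrict_cell (a : ℝ) (ha : 0 < a) : volume.restrict (cell a) =
    ENNReal.ofReal (a ^ 2 * √3 / 2) •
      Measure.map (latticeMap (v₁ a) (v₂ a)) (volume.restrict unitBox) := by
  have hpos : 0 < a ^ 2 * √3 / 2 := by positivity
  have hD : latticeDet (v₁ a) (v₂ a) ≠ 0 := by
    rw [latticeDet_v]
    linarith
  rw [map_latticeMap hD, Measure.restrict_smul,
    Measure.restrict_map (continuous_latticeMap _ _).measurable (measurableSet_cell a ha),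
    preimage_cell a ha, latticeDet_v, abs_neg, abs_of_pos hpos]
  congr 2
  refine Measure.restrict_congr_set ?_
  have h1 := Measure.univ_pi_Ico_ae_eq_Icc (μ := fun _ : Fin 2 => (volume : Measure ℝ))
    (f := 0) (g := 1)
  have h2 := Measure.univ_pi_Ioc_ae_eq_Icc (μ := fun _ : Fin 2 => (volume : Measure ℝ))
    (f := 0) (g := 1)
  have h3 : unitBox = Set.pi Set.univ fun i => Set.Ioc ((0 : Fin 2 → ℝ) i) ((1 : Fin 2 → ℝ) i) := by
    ext s
    simp [unitBox]
  rw [h3]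
  exact h1.trans h2.symm

/-- The probability Haar measure on the torus. -/
abbrev torusVolume : Measure (UnitAddTorus (Fin 2)) := Measure.pi fun _ => AddCircle.haarAddCircle

/-- The parametrization of the cell by the torus. -/
def torusMap (a : ℝ) (t : UnitAddTorus (Fin 2)) : Plane :=
  latticeMap (v₁ a) (v₂ a) (UnitAddTorus.measurableEquivPiIoc 0 t).1

theorem measurable_torusMap (a : ℝ) : Measurable (torusMap a) :=
  (continuous_latticeMap _ _).measurable.comp
    (measurable_subtype_coe.comp (UnitAddTorus.measurableEquivPiIoc 0).measurable)

theorem restrict_cell_eq_map (a : ℝ) (ha : 0 < a) : volume.restrict (cell a) =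
    ENNReal.ofReal (a ^ 2 * √3 / 2) • Measure.map (torusMap a) torusVolume := by
  rw [restrict_cell a ha]
  congr 1
  have hm : MeasurableSet unitBox := MeasurableSet.univ_pi' fun i => measurableSet_Ioc
  have h1 : Measure.map (UnitAddTorus.measurableEquivPiIoc (0 : Fin 2 → ℝ)) torusVolume = _ :=
    (UnitAddTorus.measurePreserving_equivPiIoc (0 : Fin 2 → ℝ)).map_eq
  have h2 : torusMap a = (latticeMap (v₁ a) (v₂ a) ∘ Subtype.val) ∘
    UnitAddTorus.measurableEquivPiIoc (0 : Fin 2 → ℝ) := rfl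
  rw [h2, ← Measure.map_map ((continuous_latticeMap _ _).measurable.comp measurable_subtype_coe)
    (UnitAddTorus.measurableEquivPiIoc 0).measurable, h1,
    ← Measure.map_map (continuous_latticeMap _ _).measurable measurable_subtype_coe]
  congr 1
  exact (map_comap_subtype_coe hm volume).symm

theorem area_cell (a : ℝ) (ha : 0 < a) : volume.real (cell a) = a ^ 2 * √3 / 2 := by
  have h : volume.real (cell a) = (volume.restrict (cell a)).real Set.univ := by
    simp [Measure.real]
  rw [h, restrict_cell_eq_map a ha, measureReal_ennreal_smul_apply,
    map_measureReal_apply (measurable_torusMap a) MeasurableSet.univ]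
  simp only [Set.preimage_univ, probReal_univ, mul_one]
  exact ENNReal.toReal_ofReal (by positivity)

theorem planeWave_torusMap (a : ℝ) (ha : 0 < a) (k : Plane) (m : Fin 2 → ℤ)
    (t : UnitAddTorus (Fin 2)) : planeWave a k m (torusMap a t) =
      Complex.exp (Complex.I * (inner ℝ k (torusMap a t) : ℝ)) * UnitAddTorus.mFourier m t := by
  obtain ⟨h11, h12, h21, h22⟩ := inner_k_v a ha
  set s := UnitAddTorus.measurableEquivPiIoc (0 : Fin 2 → ℝ) t with hs
  have ht : t = fun i => ((s.1 i : ℝ) : UnitAddCircle) := by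
    rw [← UnitAddTorus.coe_symm_measurableEquivPiIoc_apply, hs, MeasurableEquiv.symm_apply_apply]
  have h1 : inner ℝ (dualVec a m) (torusMap a t) =
      2 * Real.pi * (m 0 * s.1 0) + 2 * Real.pi * (m 1 * s.1 1) := by
    simp only [torusMap, latticeMap_apply, dualVec, inner_add_left, inner_add_right,
      real_inner_smul_left, real_inner_smul_right, h11, h12, h21, h22, ← hs]
    ring
  have h2 : UnitAddTorus.mFourier m t =
      Complex.exp (2 * Real.pi * Complex.I * m 0 * s.1 0 / (1 : ℝ)) *
        Complex.exp (2 * Real.pi * Complex.I * m 1 * s.1 1 / (1 : ℝ)) := by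
    conv_lhs => rw [ht]
    rw [UnitAddTorus.mFourier, ContinuousMap.coe_mk, Fin.prod_univ_two]
    simp only [fourier_coe_apply]
  rw [planeWave, inner_add_left, h1, h2, ← Complex.exp_add, ← Complex.exp_add]
  congr 1
  push_cast
  ring

theorem inner_wave (a : ℝ) (k : Plane) (m : Fin 2 → ℤ) (f : L2 a) :
    inner ℂ (wave a k m) f =
      ∫ x in cell a, starRingEnd ℂ (planeWave a k m x) * f x := by
  rw [L2.inner_def]
  refine integral_congr_ae ?_
  filter_upwards [(memLp_planeWave a k m).coeFn_toLp] with x hx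
  rw [wave, hx, RCLike.inner_apply, mul_comm]

theorem norm_exp_I_mul_sq (x : ℝ) :
    starRingEnd ℂ (Complex.exp (Complex.I * x)) * Complex.exp (Complex.I * x) = 1 := by
  rw [← Complex.normSq_eq_conj_mul_self, Complex.normSq_eq_norm_sq, mul_comm,
    Complex.norm_exp_ofReal_mul_I]
  simp

theorem continuous_planeWave (a : ℝ) (k : Plane) (m : Fin 2 → ℤ) :
    Continuous (planeWave a k m) := by
  unfold planeWave
  fun_prop

theorem inner_wave_wave (a : ℝ) (ha : 0 < a) (k : Plane) (m n : Fin 2 → ℤ) :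
    inner ℂ (wave a k m) (wave a k n) =
      if m = n then ((volume.real (cell a) : ℝ) : ℂ) else 0 := by
  have h1 : inner ℂ (wave a k m) (wave a k n) =
      ∫ x in cell a, starRingEnd ℂ (planeWave a k m x) * planeWave a k n x := by
    rw [inner_wave]
    refine integral_congr_ae ?_
    filter_upwards [(memLp_planeWave a k n).coeFn_toLp] with x hx
    rw [wave, hx]
  have h2 : ∫ t, starRingEnd ℂ (UnitAddTorus.mFourier m t) * UnitAddTorus.mFourier n t
      ∂torusVolume = if m = n then 1 else 0 := by
    rw [← orthonormal_iff_ite.1 UnitAddTorus.orthonormal_mFourier m n, ContinuousMap.inner_toLp]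
    refine integral_congr_ae (Eventually.of_forall fun t => ?_)
    exact mul_comm _ _
  rw [h1, restrict_cell_eq_map a ha, integral_smul_measure, integral_map
    (measurable_torusMap a).aemeasurable (by
      refine Continuous.aestronglyMeasurable ?_
      exact (Complex.continuous_conj.comp (continuous_planeWave a k m)).mul
        (continuous_planeWave a k n)), area_cell a ha, ENNReal.toReal_ofReal (by positivity)]
  have h3 : ∀ t, starRingEnd ℂ (planeWave a k m (torusMap a t)) * planeWave a k n (torusMap a t) =
      starRingEnd ℂ (UnitAddTorus.mFourier m t) * UnitAddTorus.mFourier n t := by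
    intro t
    rw [planeWave_torusMap a ha, planeWave_torusMap a ha, map_mul, mul_mul_mul_comm,
      norm_exp_I_mul_sq, one_mul]
  simp only [h3]
  rw [h2]
  split_ifs <;> simp

theorem eq_zero_of_inner_wave (a : ℝ) (ha : 0 < a) (k : Plane) (f : L2 a)
    (hf : ∀ m, inner ℂ (wave a k m) f = 0) : f = 0 := by
  have hc0 : ENNReal.ofReal (a ^ 2 * √3 / 2) ≠ 0 := by
    rw [Ne, ENNReal.ofReal_eq_zero, not_le]
    positivity
  set ν := Measure.map (torusMap a) torusVolume with hν
  have hμ : volume.restrict (cell a) = ENNReal.ofReal (a ^ 2 * √3 / 2) • ν :=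
    restrict_cell_eq_map a ha
  have hmp : MeasurePreserving (torusMap a) torusVolume ν := ⟨measurable_torusMap a, rfl⟩
  have hfν : MemLp f 2 ν := by
    have h := Lp.memLp f
    have hν' : ν = (ENNReal.ofReal (a ^ 2 * √3 / 2))⁻¹ • volume.restrict (cell a) := by
      rw [hμ, smul_smul, ENNReal.inv_mul_cancel hc0 ENNReal.ofReal_ne_top, one_smul]
    rw [hν']
    exact h.smul_measure (ENNReal.inv_ne_top.2 hc0)
  let g : UnitAddTorus (Fin 2) → ℂ := fun t =>
    starRingEnd ℂ (Complex.exp (Complex.I * (inner ℝ k (torusMap a t) : ℝ))) * f (torusMap a t)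
  have hgm : MemLp g 2 torusVolume := by
    refine (hfν.comp_measurePreserving hmp).of_le ?_ (Eventually.of_forall fun t => ?_)
    · refine AEStronglyMeasurable.mul ?_ (hfν.comp_measurePreserving hmp).1
      refine Measurable.aestronglyMeasurable ?_
      have : Continuous fun x : Plane =>
          starRingEnd ℂ (Complex.exp (Complex.I * (inner ℝ k x : ℝ))) := by fun_prop
      exact this.measurable.comp (measurable_torusMap a)
    · simp only [g, norm_mul, RCLike.norm_conj]
      rw [mul_comm Complex.I, Complex.norm_exp_ofReal_mul_I, one_mul]
      rfl
  have hcoef : ∀ m, UnitAddTorus.mFourierBasis.repr (hgm.toLp g) m = 0 := by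
    intro m
    have h0 : UnitAddTorus.mFourierCoeff (hgm.toLp g) m = UnitAddTorus.mFourierCoeff g m := by
      refine integral_congr_ae ?_
      filter_upwards [hgm.coeFn_toLp] with t ht
      rw [ht]
    rw [UnitAddTorus.mFourierBasis_repr, h0]
    have h1 := hf m
    have h0' : ∀ φ : Plane → ℂ, ∫ x in cell a, φ x =
        ∫ x, φ x ∂(ENNReal.ofReal (a ^ 2 * √3 / 2) • ν) := fun φ => by rw [hμ]
    rw [inner_wave, h0', integral_smul_measure, integral_map
      (measurable_torusMap a).aemeasurable (by
        refine AEStronglyMeasurable.mul ?_ hfν.1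
        exact (Complex.continuous_conj.comp
          (continuous_planeWave a k m)).aestronglyMeasurable)] at h1
    have h2 := (smul_eq_zero.1 h1).resolve_left
      (ENNReal.toReal_ne_zero.2 ⟨hc0, ENNReal.ofReal_ne_top⟩)
    rw [UnitAddTorus.mFourierCoeff, ← h2]
    refine integral_congr_ae (Eventually.of_forall fun t => ?_)
    simp only [g, planeWave_torusMap a ha, map_mul, UnitAddTorus.mFourier_neg, smul_eq_mul]
    ring
  have hg0 : hgm.toLp g = 0 := by
    apply UnitAddTorus.mFourierBasis.repr.injective
    ext m
    rw [hcoef]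
    simp
  have hg0' : g =ᵐ[torusVolume] 0 := by
    have h1 := hgm.coeFn_toLp
    rw [hg0] at h1
    exact h1.symm.trans (Lp.coeFn_zero _ _ _)
  have hf0 : f =ᵐ[ν] 0 := by
    have h1 : ∀ᵐ t ∂torusVolume, f (torusMap a t) = 0 := by
      filter_upwards [hg0'] with t ht
      exact (mul_eq_zero.1 (show _ * _ = (0 : ℂ) from ht)).resolve_left
        ((map_ne_zero (starRingEnd ℂ)).2 (Complex.exp_ne_zero _))
    obtain ⟨f', hf'm, hff'⟩ := hfν.1
    have h2 : ∀ᵐ t ∂torusVolume, f' (torusMap a t) = 0 := by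
      filter_upwards [h1, hmp.quasiMeasurePreserving.ae hff'] with t h1 h2
      rw [← h2, h1]
    have h3 : ∀ᵐ x ∂ν, f' x = 0 :=
      (ae_map_iff (measurable_torusMap a).aemeasurable
        (hf'm.measurable (measurableSet_singleton 0))).2 h2
    filter_upwards [h3, hff'] with x h3 h4
    rw [h4, h3]
    rfl
  have h : ∀ μ' : Measure Plane, μ' = ENNReal.ofReal (a ^ 2 * √3 / 2) • ν →
      ∀ φ : Plane → ℂ, φ =ᵐ[ν] 0 → φ =ᵐ[μ'] 0 := by
    rintro _ rfl φ hφ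
    exact Measure.ae_smul_measure hφ _
  rw [Lp.eq_zero_iff_ae_eq_zero]
  exact h _ hμ f hf0

theorem area_pos (a : ℝ) (ha : 0 < a) : 0 < volume.real (cell a) := by
  rw [area_cell a ha]
  positivity

theorem area_ne_zero (a : ℝ) (ha : 0 < a) : ((volume.real (cell a) : ℝ) : ℂ) ≠ 0 :=
  Complex.ofReal_ne_zero.2 (area_pos a ha).ne'

theorem orthonormal_wave (a : ℝ) (ha : 0 < a) (k : Plane) :
    Orthonormal ℂ fun m => (((√(volume.real (cell a)))⁻¹ : ℝ) : ℂ) • wave a k m := by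
  have h := area_pos a ha
  rw [orthonormal_iff_ite]
  intro m n
  rw [inner_smul_left, inner_smul_right, inner_wave_wave a ha, Complex.conj_ofReal]
  split_ifs
  · rw [← Complex.ofReal_mul, ← Complex.ofReal_mul, ← Complex.ofReal_one]
    congr 1
    have h2 : √(volume.real (cell a)) ^ 2 = volume.real (cell a) := Real.sq_sqrt h.le
    have h3 : √(volume.real (cell a)) ≠ 0 := by positivity
    field_simp
    exact h2.symm
  · simp

/-- The normalized plane waves. -/
def waveBasis (a : ℝ) (ha : 0 < a) (k : Plane) : HilbertBasis (Fin 2 → ℤ) ℂ (L2 a) :=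
  HilbertBasis.mkOfOrthogonalEqBot (orthonormal_wave a ha k) <| by
    rw [Submodule.eq_bot_iff]
    intro f hf
    refine eq_zero_of_inner_wave a ha k f fun m => ?_
    have h := (Submodule.mem_orthogonal _ _).1 hf _ (Submodule.subset_span ⟨m, rfl⟩)
    rw [inner_smul_left] at h
    refine (mul_eq_zero.1 h).resolve_left ?_
    have h0 : (√(volume.real (cell a)))⁻¹ ≠ 0 := by
      have := area_pos a ha
      positivity
    rwa [Complex.conj_ofReal, Complex.ofReal_eq_zero]

theorem waveBasis_apply (a : ℝ) (ha : 0 < a) (k : Plane) (m : Fin 2 → ℤ) :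
    waveBasis a ha k m = (((√(volume.real (cell a)))⁻¹ : ℝ) : ℂ) • wave a k m :=
  congrFun (HilbertBasis.coe_mkOfOrthogonalEqBot _ _) m

theorem inner_waveBasis (a : ℝ) (ha : 0 < a) (k : Plane) (m : Fin 2 → ℤ) (f : L2 a) :
    inner ℂ (waveBasis a ha k m) f = ((√(volume.real (cell a)) : ℝ) : ℂ) * coeff a k m f := by
  have h := area_pos a ha
  have h2 : √(volume.real (cell a)) ^ 2 = volume.real (cell a) := Real.sq_sqrt h.le
  have h3 : √(volume.real (cell a)) ≠ 0 := by positivity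
  rw [waveBasis_apply, inner_smul_left, Complex.conj_ofReal, coeff, ← mul_assoc,
    ← Complex.ofReal_inv, ← Complex.ofReal_mul]
  congr 2
  field_simp
  exact h2.symm

theorem hasSum_inner (a : ℝ) (ha : 0 < a) (k : Plane) (f g : L2 a) :
    HasSum (fun m => ((volume.real (cell a) : ℝ) : ℂ) *
      (starRingEnd ℂ (coeff a k m f) * coeff a k m g)) (inner ℂ f g) := by
  have h := (waveBasis a ha k).hasSum_inner_mul_inner f g
  refine (congrArg (HasSum · (inner ℂ f g)) (funext fun m => ?_)).mpr h
  rw [← inner_conj_symm f, inner_waveBasis, inner_waveBasis, map_mul, Complex.conj_ofReal,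
    mul_mul_mul_comm, ← Complex.ofReal_mul, Real.mul_self_sqrt (area_pos a ha).le]

theorem summable_norm_coeff_sq (a : ℝ) (ha : 0 < a) (k : Plane) (f : L2 a) :
    Summable fun m => ‖coeff a k m f‖ ^ 2 := by
  have h := (hasSum_inner a ha k f f).summable.norm
  refine (summable_mul_left_iff (area_pos a ha).ne').1 (h.congr fun m => ?_)
  rw [norm_mul, norm_mul, RCLike.norm_conj, Complex.norm_real,
    Real.norm_of_nonneg (area_pos a ha).le, sq]

theorem coeff_ext (a : ℝ) (ha : 0 < a) (k : Plane) {f g : L2 a}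
    (h : ∀ m, coeff a k m f = coeff a k m g) : f = g := by
  apply (waveBasis a ha k).repr.injective
  ext m
  rw [HilbertBasis.repr_apply_apply, HilbertBasis.repr_apply_apply, inner_waveBasis,
    inner_waveBasis, h]

theorem exists_coeff_eq (a : ℝ) (ha : 0 < a) (k : Plane) {c : (Fin 2 → ℤ) → ℂ}
    (hc : Summable fun m => ‖c m‖ ^ 2) : ∃ f : L2 a, ∀ m, coeff a k m f = c m := by
  have hs : ((√(volume.real (cell a)) : ℝ) : ℂ) ≠ 0 := by
    rw [Complex.ofReal_ne_zero]
    have := area_pos a ha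
    positivity
  have hmem : Memℓp (fun m => ((√(volume.real (cell a)) : ℝ) : ℂ) * c m) 2 := by
    rw [memℓp_gen_iff (by simp)]
    refine (hc.mul_left (volume.real (cell a))).congr fun m => ?_
    simp only [ENNReal.toReal_ofNat, Real.rpow_ofNat]
    rw [norm_mul, mul_pow, Complex.norm_real, Real.norm_of_nonneg (Real.sqrt_nonneg _),
      Real.sq_sqrt (area_pos a ha).le]
  refine ⟨(waveBasis a ha k).repr.symm ⟨_, hmem⟩, fun m => ?_⟩
  apply mul_left_cancel₀ hs
  rw [← inner_waveBasis a ha, ← HilbertBasis.repr_apply_apply, LinearIsometryEquiv.apply_symm_apply]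

/-! ### Lattice sums -/

/-- The momentum `|ξ_m + k|`. -/
abbrev freq (a : ℝ) (k : Plane) (m : Fin 2 → ℤ) : ℝ := ‖dualVec a m + k‖

/-- The momenta `m` with `|ξ_m + k| ≤ r`. -/
def dualBall (a : ℝ) (ha : 0 < a) (k : Plane) (r : ℝ) : Finset (Fin 2 → ℤ) :=
  (finite_dual_ball a ha k r).toFinset

theorem mem_dualBall {a : ℝ} {ha : 0 < a} {k : Plane} {r : ℝ} {m : Fin 2 → ℤ} :
    m ∈ dualBall a ha k r ↔ freq a k m ≤ r := by
  simp [dualBall]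

theorem monotone_dualBall (a : ℝ) (ha : 0 < a) (k : Plane) : Monotone (dualBall a ha k) := by
  intro r r' h m hm
  exact mem_dualBall.2 ((mem_dualBall.1 hm).trans h)

theorem tendsto_dualBall (a : ℝ) (ha : 0 < a) (k : Plane) :
    Tendsto (dualBall a ha k) atTop atTop :=
  tendsto_atTop_finset_of_monotone (monotone_dualBall a ha k) fun m =>
    ⟨freq a k m, mem_dualBall.2 le_rfl⟩

theorem norm_le_freq (a : ℝ) (ha : 0 < a) (k : Plane) :
    ∃ C > 0, ∀ m : Fin 2 → ℤ, ‖m‖ ≤ C * (1 + freq a k m) := by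
  obtain ⟨h11, h12, h21, h22⟩ := inner_k_v a ha
  have hpi := Real.pi_gt_three
  have hC : 0 < (1 + ‖k‖) * (‖v₁ a‖ + ‖v₂ a‖) + 1 := by positivity
  refine ⟨_, hC, fun m => ?_⟩
  have key : ∀ (v : Plane) (n : ℤ), ‖v‖ ≤ ‖v₁ a‖ + ‖v₂ a‖ →
      inner ℝ (dualVec a m) v = n * (2 * Real.pi) →
      |(n : ℝ)| ≤ ((1 + ‖k‖) * (‖v₁ a‖ + ‖v₂ a‖) + 1) * (1 + freq a k m) := by
    intro v n hv hn
    have h1 : ‖dualVec a m‖ ≤ freq a k m + ‖k‖ := by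
      simpa using norm_sub_le (dualVec a m + k) k
    have h2 := abs_real_inner_le_norm (dualVec a m) v
    rw [hn, abs_mul, abs_of_pos (by positivity : 0 < 2 * Real.pi)] at h2
    have h3 : ‖dualVec a m‖ * ‖v‖ ≤ (freq a k m + ‖k‖) * (‖v₁ a‖ + ‖v₂ a‖) := by gcongr
    have h4 : freq a k m + ‖k‖ ≤ (1 + ‖k‖) * (1 + freq a k m) := by
      nlinarith [norm_nonneg k, norm_nonneg (dualVec a m + k),
        mul_nonneg (norm_nonneg k) (norm_nonneg (dualVec a m + k))]
    have h5 := mul_le_mul_of_nonneg_right h4 (by positivity : 0 ≤ ‖v₁ a‖ + ‖v₂ a‖)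
    nlinarith [abs_nonneg (n : ℝ), norm_nonneg (dualVec a m + k)]
  rw [pi_norm_le_iff_of_nonneg (by positivity)]
  intro i
  rw [Int.norm_eq_abs]
  fin_cases i
  · refine key (v₁ a) (m 0) (le_add_of_nonneg_right (norm_nonneg _)) ?_
    simp [dualVec, inner_add_left, real_inner_smul_left, h11, h21]
  · refine key (v₂ a) (m 1) (le_add_of_nonneg_left (norm_nonneg _)) ?_
    simp [dualVec, inner_add_left, real_inner_smul_left, h12, h22]

theorem summable_freq_cube (a : ℝ) (ha : 0 < a) (k : Plane) :
    Summable fun m => ((1 + freq a k m) ^ 3)⁻¹ := by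
  obtain ⟨C, hC, hb⟩ := norm_le_freq a ha k
  have h := (EisensteinSeries.summable_one_div_norm_rpow (k := 3) (by norm_num)).mul_left (C ^ 3)
  refine h.of_norm_bounded_eventually ?_
  refine (Set.finite_singleton (0 : Fin 2 → ℤ)).subset fun m hm => ?_
  by_contra hm0
  refine hm ?_
  change ‖((1 + freq a k m) ^ 3)⁻¹‖ ≤ C ^ 3 * ‖m‖ ^ (-3 : ℝ)
  have h0 : 0 < ‖m‖ := norm_pos_iff.2 hm0
  have h1 : 0 < 1 + freq a k m := by positivity
  rw [Real.norm_of_nonneg (by positivity), Real.rpow_neg h0.le,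
    show (3 : ℝ) = (3 : ℕ) by norm_num, Real.rpow_natCast, ← div_eq_mul_inv,
    inv_le_comm₀ (by positivity) (by positivity), inv_div, div_le_iff₀ (by positivity), mul_comm,
    ← mul_pow]
  exact pow_le_pow_left₀ h0.le (hb m) 3

theorem inv_one_add_sq_le {u : ℝ} (hu : 0 ≤ u) : (1 + u ^ 2)⁻¹ ≤ 2 * ((1 + u) ^ 2)⁻¹ := by
  rw [inv_le_iff_one_le_mul₀ (by positivity), ← div_eq_mul_inv, ← mul_div_right_comm,
    le_div_iff₀ (by positivity)]
  nlinarith [sq_nonneg (1 - u)]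

theorem summable_freq_four (a : ℝ) (ha : 0 < a) (k : Plane) :
    Summable fun m => ((1 + freq a k m ^ 2) ^ 2)⁻¹ := by
  refine ((summable_freq_cube a ha k).mul_left 4).of_nonneg_of_le (fun m => by positivity)
    fun m => ?_
  have h0 : 0 ≤ freq a k m := norm_nonneg _
  have h1 := inv_one_add_sq_le h0
  rw [← inv_pow]
  calc (1 + freq a k m ^ 2)⁻¹ ^ 2 ≤ (2 * ((1 + freq a k m) ^ 2)⁻¹) ^ 2 :=
        pow_le_pow_left₀ (by positivity) h1 2
    _ = 4 * ((1 + freq a k m) ^ 4)⁻¹ := by field_simp; norm_num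
    _ ≤ 4 * ((1 + freq a k m) ^ 3)⁻¹ := by
        gcongr
        · linarith
        · norm_num

/-- The density `(1 + u²)⁻¹` varies by `O((1 + u)⁻³)` over bounded distances. -/
theorem abs_inv_one_add_sq_sub_le {u v d : ℝ} (hu : 0 ≤ u) (hv : 0 ≤ v) (hd : |u - v| ≤ d) :
    |(1 + u ^ 2)⁻¹ - (1 + v ^ 2)⁻¹| ≤ 4 * d * (1 + d) ^ 2 * (2 + d) * ((1 + u) ^ 3)⁻¹ := by
  have hd0 : 0 ≤ d := (abs_nonneg _).trans hd
  obtain ⟨hd1, hd2⟩ := abs_le.1 hd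
  have h1 : 1 + u ≤ (1 + d) * (1 + v) := by nlinarith
  have h2 : u + v ≤ (2 + d) * (1 + u) := by nlinarith
  have h3 : (1 + u ^ 2)⁻¹ - (1 + v ^ 2)⁻¹ =
      (v - u) * (u + v) * ((1 + u ^ 2)⁻¹ * (1 + v ^ 2)⁻¹) := by
    field_simp
    ring
  have h4 : (1 + v ^ 2)⁻¹ ≤ 2 * ((1 + d) ^ 2 * ((1 + u) ^ 2)⁻¹) := by
    refine (inv_one_add_sq_le hv).trans ?_
    gcongr
    rw [inv_le_iff_one_le_mul₀ (by positivity), mul_assoc, mul_comm, mul_assoc,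
      ← div_eq_inv_mul, le_div_iff₀ (by positivity), one_mul, ← mul_pow]
    exact pow_le_pow_left₀ (by positivity) (by linarith) 2
  rw [h3, abs_mul, abs_mul, abs_sub_comm, abs_of_nonneg (by positivity : 0 ≤ u + v),
    abs_of_nonneg (by positivity : 0 ≤ (1 + u ^ 2)⁻¹ * (1 + v ^ 2)⁻¹)]
  calc |u - v| * (u + v) * ((1 + u ^ 2)⁻¹ * (1 + v ^ 2)⁻¹)
      ≤ d * ((2 + d) * (1 + u)) *
        ((2 * ((1 + u) ^ 2)⁻¹) * (2 * ((1 + d) ^ 2 * ((1 + u) ^ 2)⁻¹))) := by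
        gcongr
        exact inv_one_add_sq_le hu
    _ = 4 * d * (1 + d) ^ 2 * (2 + d) * ((1 + u) ^ 3)⁻¹ := by
        field_simp
        ring

theorem integral_closedBall_inv_one_add_sq {ρ : ℝ} (hρ : 0 ≤ ρ) :
    ∫ x in Metric.closedBall (0 : Plane) ρ, (1 + ‖x‖ ^ 2)⁻¹ = Real.pi * Real.log (1 + ρ ^ 2) := by
  have h1 : ∫ x in Metric.closedBall (0 : Plane) ρ, (1 + ‖x‖ ^ 2)⁻¹ =
      ∫ x : Plane, (Set.Iic ρ).indicator (fun y => (1 + y ^ 2)⁻¹) ‖x‖ := by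
    rw [← integral_indicator Metric.isClosed_closedBall.measurableSet]
    refine integral_congr_ae (Eventually.of_forall fun x => ?_)
    by_cases h : ‖x‖ ≤ ρ <;> simp [Set.indicator, h]
  have h2 : ∫ y in Set.Ioi (0 : ℝ), y ^ 1 • (Set.Iic ρ).indicator (fun y => (1 + y ^ 2)⁻¹) y =
      ∫ y in (0 : ℝ)..ρ, y * (1 + y ^ 2)⁻¹ := by
    rw [intervalIntegral.integral_of_le hρ, ← Set.Ioi_inter_Iic, ← Set.inter_comm,
      ← Measure.restrict_restrict measurableSet_Iic, ← integral_indicator measurableSet_Iic]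
    refine integral_congr_ae (Eventually.of_forall fun y => ?_)
    simp only [Set.indicator_apply, smul_eq_mul, pow_one]
    split_ifs <;> simp
  have h3 : ∫ y in (0 : ℝ)..ρ, y * (1 + y ^ 2)⁻¹ = 1 / 2 * Real.log (1 + ρ ^ 2) := by
    have hd : ∀ y ∈ Set.uIcc 0 ρ,
        HasDerivAt (fun y : ℝ => 1 / 2 * Real.log (1 + y ^ 2)) (y * (1 + y ^ 2)⁻¹) y := by
      intro y _
      have hy : (1 + y ^ 2) ≠ 0 := by positivity
      have := (((hasDerivAt_pow 2 y).const_add 1).log hy).const_mul (1 / 2)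
      refine this.congr_deriv ?_
      simp only [Nat.cast_ofNat, Nat.add_one_sub_one, pow_one]
      field_simp
    rw [intervalIntegral.integral_eq_sub_of_hasDerivAt hd]
    · simp
    · refine Continuous.intervalIntegrable ?_ _ _
      exact continuous_id.mul ((by fun_prop : Continuous fun y : ℝ => 1 + y ^ 2).inv₀
        fun y => by positivity)
  rw [h1, integral_fun_norm_addHaar volume (fun y => (Set.Iic ρ).indicator _ y),
    finrank_euclideanSpace_fin, show 2 - 1 = 1 from rfl, h2, h3, Measure.real,
    EuclideanSpace.volume_ball_fin_two]
  simp [Real.pi_pos.le]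
  ring

/-- The unit square with lower left corner `m`. -/
def tile (m : Fin 2 → ℤ) : Set (Fin 2 → ℝ) :=
  Set.pi Set.univ fun i => Set.Ioc (m i : ℝ) (m i + 1)

theorem measurableSet_tile (m : Fin 2 → ℤ) : MeasurableSet (tile m) :=
  MeasurableSet.univ_pi fun _ => measurableSet_Ioc

theorem volume_tile (m : Fin 2 → ℤ) : volume (tile m) = 1 := by
  rw [tile, Real.volume_pi_Ioc]
  simp

theorem pairwise_disjoint_tile : Pairwise (Function.onFun Disjoint tile) := by
  intro m n hmn
  rw [Function.onFun, Set.disjoint_left]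
  intro s hm hn
  apply hmn
  funext i
  obtain ⟨h1, h2⟩ := hm i trivial
  obtain ⟨h3, h4⟩ := hn i trivial
  have h5 : (m i : ℝ) < n i + 1 := h1.trans_le h4
  have h6 : (n i : ℝ) < m i + 1 := h3.trans_le h2
  norm_cast at h5 h6
  omega

theorem exists_mem_tile (s : Fin 2 → ℝ) : ∃ m, s ∈ tile m := by
  refine ⟨fun i => ⌈s i⌉ - 1, fun i _ => ⟨?_, ?_⟩⟩
  · push_cast
    linarith [Int.ceil_lt_add_one (s i)]
  · push_cast
    linarith [Int.le_ceil (s i)]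

/-- The dual plane in lattice coordinates, centered at `-k`. -/
def dualPoint (a : ℝ) (k : Plane) (s : Fin 2 → ℝ) : Plane := latticeMap (k₁ a) (k₂ a) s + k

theorem continuous_dualPoint (a : ℝ) (k : Plane) : Continuous (dualPoint a k) :=
  (continuous_latticeMap _ _).add continuous_const

theorem norm_dualPoint_sub_le (a : ℝ) (k : Plane) {m : Fin 2 → ℤ} {s : Fin 2 → ℝ}
    (hs : s ∈ tile m) : |freq a k m - ‖dualPoint a k s‖| ≤ ‖k₁ a‖ + ‖k₂ a‖ := by
  refine (abs_norm_sub_norm_le _ _).trans ?_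
  have h1 : dualVec a m + k - dualPoint a k s =
      ((m 0 : ℝ) - s 0) • k₁ a + ((m 1 : ℝ) - s 1) • k₂ a := by
    simp only [dualVec, dualPoint, latticeMap_apply, sub_smul]
    abel
  have h2 : ∀ i, ‖(m i : ℝ) - s i‖ ≤ 1 := by
    intro i
    obtain ⟨h3, h4⟩ := hs i trivial
    rw [Real.norm_eq_abs, abs_le]
    constructor <;> linarith
  rw [h1]
  refine (norm_add_le _ _).trans ?_
  rw [norm_smul, norm_smul]
  exact add_le_add (mul_le_of_le_one_left (norm_nonneg _) (h2 0))
    (mul_le_of_le_one_left (norm_nonneg _) (h2 1))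

theorem continuous_density (a : ℝ) (k : Plane) :
    Continuous fun s => (1 + ‖dualPoint a k s‖ ^ 2)⁻¹ := by
  have := continuous_dualPoint a k
  exact (by fun_prop : Continuous fun s => 1 + ‖dualPoint a k s‖ ^ 2).inv₀ fun s => by positivity

theorem latticeDet_k_ne_zero (a : ℝ) (ha : 0 < a) : latticeDet (k₁ a) (k₂ a) ≠ 0 := by
  rw [latticeDet_k a ha]
  have : 0 < 4 * Real.pi ^ 2 / (a ^ 2 * √3 / 2) := by positivity
  linarith

theorem integral_dualPoint (a : ℝ) (ha : 0 < a) (k : Plane) (f : Plane → ℝ) :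
    ∫ s, f (dualPoint a k s) = volume.real (cell a) / (4 * Real.pi ^ 2) * ∫ x, f x := by
  have hD := latticeDet_k_ne_zero a ha
  have hemb : MeasurableEmbedding (latticeMap (k₁ a) (k₂ a)) :=
    (continuous_latticeMap _ _).measurableEmbedding (injective_latticeMap hD)
  have h1 : ∫ x, f x = ∫ x, f (x + k) := (integral_add_right_eq_self f k).symm
  have h2 : ∫ x, f (x + k) = |latticeDet (k₁ a) (k₂ a)| *
      ∫ s, f (latticeMap (k₁ a) (k₂ a) s + k) := by
    conv_lhs => rw [map_latticeMap hD]
    rw [integral_smul_measure, hemb.integral_map, ENNReal.toReal_ofReal (abs_nonneg _),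
      smul_eq_mul]
  have h3 : |latticeDet (k₁ a) (k₂ a)| = 4 * Real.pi ^ 2 / volume.real (cell a) := by
    rw [latticeDet_k a ha, abs_neg, abs_of_pos (by positivity), area_cell a ha]
  have h4 := area_pos a ha
  rw [h1, h2, h3]
  field_simp
  rfl

theorem integral_dualPoint_ball (a : ℝ) (ha : 0 < a) (k : Plane) {ρ : ℝ} (hρ : 0 ≤ ρ) :
    ∫ s in {s | ‖dualPoint a k s‖ ≤ ρ}, (1 + ‖dualPoint a k s‖ ^ 2)⁻¹ =
      volume.real (cell a) / (4 * Real.pi) * Real.log (1 + ρ ^ 2) := by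
  have hm : MeasurableSet {s | ‖dualPoint a k s‖ ≤ ρ} :=
    (isClosed_le (continuous_dualPoint a k).norm continuous_const).measurableSet
  have h1 : ∫ s in {s | ‖dualPoint a k s‖ ≤ ρ}, (1 + ‖dualPoint a k s‖ ^ 2)⁻¹ =
      ∫ s, (Metric.closedBall (0 : Plane) ρ).indicator (fun x => (1 + ‖x‖ ^ 2)⁻¹)
        (dualPoint a k s) := by
    rw [← integral_indicator hm]
    refine integral_congr_ae (Eventually.of_forall fun s => ?_)
    by_cases h : ‖dualPoint a k s‖ ≤ ρ <;> simp [Set.indicator, h]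
  rw [h1, integral_dualPoint a ha, integral_indicator Metric.isClosed_closedBall.measurableSet,
    integral_closedBall_inv_one_add_sq hρ]
  have := Real.pi_pos
  field_simp

theorem isBounded_dualPoint_ball (a : ℝ) (ha : 0 < a) (k : Plane) (ρ : ℝ) :
    {s | ‖dualPoint a k s‖ ≤ ρ} ⊆ ⋃ m ∈ dualBall a ha k (ρ + (‖k₁ a‖ + ‖k₂ a‖)), tile m := by
  intro s hs
  obtain ⟨m, hm⟩ := exists_mem_tile s
  refine Set.mem_biUnion (mem_dualBall.2 ?_) hm
  have h1 := abs_le.1 (norm_dualPoint_sub_le a k hm)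
  have h2 : ‖dualPoint a k s‖ ≤ ρ := hs
  linarith [h1.2]

theorem integrableOn_tile (a : ℝ) (k : Plane) (m : Fin 2 → ℤ) :
    IntegrableOn (fun s => (1 + ‖dualPoint a k s‖ ^ 2)⁻¹) (tile m) := by
  refine Measure.integrableOn_of_bounded (M := 1) (by simp [volume_tile])
    (continuous_density a k).aestronglyMeasurable (Eventually.of_forall fun s => ?_)
  rw [Real.norm_of_nonneg (by positivity)]
  exact inv_le_one_of_one_le₀ (by linarith [sq_nonneg ‖dualPoint a k s‖])

theorem integrableOn_biUnion_tile (a : ℝ) (k : Plane) (F : Finset (Fin 2 → ℤ)) :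
    IntegrableOn (fun s => (1 + ‖dualPoint a k s‖ ^ 2)⁻¹) (⋃ m ∈ F, tile m) :=
  integrableOn_finset_iUnion.2 fun m _ => integrableOn_tile a k m

theorem sum_tile_integral_le (a : ℝ) (ha : 0 < a) (k : Plane) {r : ℝ} (hr : 0 ≤ r) :
    ∑ m ∈ dualBall a ha k r, ∫ s in tile m, (1 + ‖dualPoint a k s‖ ^ 2)⁻¹ ≤
      volume.real (cell a) / (4 * Real.pi) *
        Real.log (1 + (r + (‖k₁ a‖ + ‖k₂ a‖)) ^ 2) := by
  rw [← integral_biUnion_finset _ (fun m _ => measurableSet_tile m)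
    (fun m _ n _ h => pairwise_disjoint_tile h) fun m _ => integrableOn_tile a k m,
    ← integral_dualPoint_ball a ha k (by positivity)]
  refine setIntegral_mono_set ((integrableOn_biUnion_tile a k _).mono_set
    (isBounded_dualPoint_ball a ha k _)) (Eventually.of_forall fun s => by positivity)
    (LE.le.eventuallyLE ?_)
  intro s hs
  simp only [Set.mem_iUnion] at hs
  obtain ⟨m, hm, hs⟩ := hs
  have h1 := abs_le.1 (norm_dualPoint_sub_le a k hs)
  have h2 := mem_dualBall.1 hm
  change ‖dualPoint a k s‖ ≤ _
  linarith [h1.1]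

theorem le_sum_tile_integral (a : ℝ) (ha : 0 < a) (k : Plane) {r : ℝ}
    (hr : ‖k₁ a‖ + ‖k₂ a‖ ≤ r) :
    volume.real (cell a) / (4 * Real.pi) * Real.log (1 + (r - (‖k₁ a‖ + ‖k₂ a‖)) ^ 2) ≤
      ∑ m ∈ dualBall a ha k r, ∫ s in tile m, (1 + ‖dualPoint a k s‖ ^ 2)⁻¹ := by
  rw [← integral_biUnion_finset _ (fun m _ => measurableSet_tile m)
    (fun m _ n _ h => pairwise_disjoint_tile h) fun m _ => integrableOn_tile a k m,
    ← integral_dualPoint_ball a ha k (sub_nonneg.2 hr)]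
  refine setIntegral_mono_set (integrableOn_biUnion_tile a k _)
    (Eventually.of_forall fun s => by positivity) (LE.le.eventuallyLE ?_)
  have := isBounded_dualPoint_ball a ha k (r - (‖k₁ a‖ + ‖k₂ a‖))
  rwa [sub_add_cancel] at this

theorem tendsto_log_one_add_sq_sub (d : ℝ) :
    Tendsto (fun r : ℝ => Real.log (1 + (r + d) ^ 2) - 2 * Real.log r) atTop (𝓝 0) := by
  have h1 : Tendsto (fun r : ℝ => (r⁻¹) ^ 2 + (1 + d * r⁻¹) ^ 2) atTop
      (𝓝 (0 ^ 2 + (1 + d * 0) ^ 2)) :=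
    (tendsto_inv_atTop_zero.pow 2).add (((tendsto_inv_atTop_zero.const_mul d).const_add 1).pow 2)
  rw [show (0 : ℝ) ^ 2 + (1 + d * 0) ^ 2 = 1 by norm_num] at h1
  have h2 := (Real.continuousAt_log one_ne_zero).tendsto.comp h1
  rw [Real.log_one] at h2
  refine h2.congr' ?_
  filter_upwards [eventually_gt_atTop 0] with r hr
  have h3 : (r⁻¹) ^ 2 + (1 + d * r⁻¹) ^ 2 = (1 + (r + d) ^ 2) / r ^ 2 := by
    field_simp
  rw [Function.comp_apply, h3, Real.log_div (by positivity) (by positivity), Real.log_pow]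
  norm_num

theorem exists_tendsto_sum_diagonal (a : ℝ) (ha : 0 < a) (k : Plane) :
    ∃ A, Tendsto (fun r => ∑ m ∈ dualBall a ha k r, (1 + freq a k m ^ 2)⁻¹ -
      volume.real (cell a) / (2 * Real.pi) * Real.log r) atTop (𝓝 A) := by
  set d := ‖k₁ a‖ + ‖k₂ a‖ with hd
  set t : (Fin 2 → ℤ) → ℝ := fun m => ∫ s in tile m, (1 + ‖dualPoint a k s‖ ^ 2)⁻¹ with ht
  have hsum : Summable fun m => (1 + freq a k m ^ 2)⁻¹ - t m := by
    refine ((summable_freq_cube a ha k).mul_left (4 * d * (1 + d) ^ 2 * (2 + d))).of_norm_bounded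
      fun m => ?_
    have h1 : (1 + freq a k m ^ 2)⁻¹ = ∫ s in tile m, (1 + freq a k m ^ 2)⁻¹ := by
      rw [setIntegral_const, Measure.real, volume_tile]
      simp
    rw [h1, ht, ← integral_sub (integrableOn_const (s := tile m) (C := (1 + freq a k m ^ 2)⁻¹)
      (by simp [volume_tile])).integrable
      (integrableOn_tile a k m)]
    refine (norm_setIntegral_le_of_norm_le_const (by simp [volume_tile]) fun s hs =>
      abs_inv_one_add_sq_sub_le (norm_nonneg _) (norm_nonneg _)
        (norm_dualPoint_sub_le a k hs)).trans ?_
    rw [Measure.real, volume_tile, ENNReal.toReal_one, mul_one]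
  have h1 := hsum.hasSum.comp (tendsto_dualBall a ha k)
  have h2 : Tendsto (fun r => ∑ m ∈ dualBall a ha k r, t m -
      volume.real (cell a) / (2 * Real.pi) * Real.log r) atTop (𝓝 0) := by
    have hup := (tendsto_log_one_add_sq_sub d).const_mul (volume.real (cell a) / (4 * Real.pi))
    have hlo := (tendsto_log_one_add_sq_sub (-d)).const_mul (volume.real (cell a) / (4 * Real.pi))
    rw [mul_zero] at hup hlo
    refine tendsto_of_tendsto_of_tendsto_of_le_of_le' hlo hup ?_ ?_
    · filter_upwards [eventually_ge_atTop d] with r hr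
      have h3 := le_sum_tile_integral a ha k hr
      have h4 : volume.real (cell a) / (2 * Real.pi) * Real.log r =
        volume.real (cell a) / (4 * Real.pi) * (2 * Real.log r) := by
        field_simp
        ring
      rw [h4, mul_sub, ← sub_eq_add_neg]
      exact sub_le_sub_right h3 _
    · filter_upwards [eventually_ge_atTop 0] with r hr
      have h3 := sum_tile_integral_le a ha k hr
      have h4 : volume.real (cell a) / (2 * Real.pi) * Real.log r =
        volume.real (cell a) / (4 * Real.pi) * (2 * Real.log r) := by
        field_simp
        ring
      rw [h4, mul_sub]
      exact sub_le_sub_right h3 _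
  refine ⟨_, (h1.add h2).congr fun r => ?_⟩
  rw [Function.comp_apply, Finset.sum_sub_distrib]
  ring

theorem tendsto_sum_annulus (a : ℝ) (ha : 0 < a) (k : Plane) (d : ℝ) :
    Tendsto (fun r => ∑ m ∈ dualBall a ha k (r + d), (1 + freq a k m ^ 2)⁻¹ -
      ∑ m ∈ dualBall a ha k (r - d), (1 + freq a k m ^ 2)⁻¹) atTop (𝓝 0) := by
  obtain ⟨A, hA⟩ := exists_tendsto_sum_diagonal a ha k
  have h1 := hA.comp (tendsto_atTop_add_const_right atTop d tendsto_id)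
  have h2 := hA.comp (tendsto_atTop_add_const_right atTop (-d) tendsto_id)
  have h3 := ((Real.tendsto_log_comp_add_sub_log d).sub
    (Real.tendsto_log_comp_add_sub_log (-d))).const_mul (volume.real (cell a) / (2 * Real.pi))
  have h4 := (h1.sub h2).add h3
  simp only [sub_self, mul_zero, add_zero] at h4
  refine h4.congr fun r => ?_
  simp only [Function.comp_apply, id, sub_eq_add_neg]
  ring

theorem freq_add_single_le (a : ℝ) (k : Plane) (m : Fin 2 → ℤ) :
    |freq a k m - freq a k (m + ![1, 0])| ≤ ‖k₁ a‖ := by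
  refine (abs_norm_sub_norm_le _ _).trans (le_of_eq ?_)
  rw [← norm_neg]
  congr 1
  simp [dualVec, add_smul]

theorem norm_sum_sub_sum_le {ι : Type*} [DecidableEq ι] {f : ι → ℂ} {g : ι → ℝ}
    (hfg : ∀ i, ‖f i‖ ≤ g i) {L A B U : Finset ι} (hLA : L ⊆ A) (hLB : L ⊆ B) (hAU : A ⊆ U)
    (hBU : B ⊆ U) : ‖∑ i ∈ A, f i - ∑ i ∈ B, f i‖ ≤ 2 * (∑ i ∈ U, g i - ∑ i ∈ L, g i) := by
  have hpart : ∀ {C : Finset ι}, L ⊆ C → C ⊆ U →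
      ‖∑ i ∈ C, f i - ∑ i ∈ L, f i‖ ≤ ∑ i ∈ U, g i - ∑ i ∈ L, g i := by
    intro C hLC hCU
    rw [← Finset.sum_sdiff hLC, add_sub_cancel_right, ← Finset.sum_sdiff (hLC.trans hCU),
      add_sub_cancel_right]
    refine (norm_sum_le_of_le _ fun i _ => hfg i).trans ?_
    exact Finset.sum_le_sum_of_subset_of_nonneg (Finset.sdiff_subset_sdiff hCU le_rfl)
      fun i _ _ => (norm_nonneg _).trans (hfg i)
  have h1 : ∑ i ∈ A, f i - ∑ i ∈ B, f i =
      (∑ i ∈ A, f i - ∑ i ∈ L, f i) - (∑ i ∈ B, f i - ∑ i ∈ L, f i) := by ring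
  rw [h1]
  refine (norm_sub_le _ _).trans ?_
  linarith [hpart hLA hAU, hpart hLB hBU]

theorem exists_tendsto_sum_oscillating (a : ℝ) (ha : 0 < a) (k : Plane) {c : (Fin 2 → ℤ) → ℂ}
    (hc : ∀ m, ‖c m‖ = 1) {ω : ℂ} (hω : ω ≠ 1) (hcω : ∀ m, c (m + ![1, 0]) = ω * c m) :
    ∃ B, Tendsto (fun r => ∑ m ∈ dualBall a ha k r, c m * ((1 + freq a k m ^ 2)⁻¹ : ℝ)) atTop
      (𝓝 B) := by
  classical
  obtain ⟨g, hg⟩ : ∃ g : (Fin 2 → ℤ) → ℝ, ∀ m, g m = (1 + freq a k m ^ 2)⁻¹ := ⟨_, fun _ => rfl⟩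
  have hg0 : ∀ m, 0 ≤ g m := fun m => by rw [hg]; positivity
  set d := ‖k₁ a‖ with hd
  have hsum : Summable fun m => c (m + ![1, 0]) * ((g m - g (m + ![1, 0]) : ℝ) : ℂ) := by
    refine ((summable_freq_cube a ha k).mul_left (4 * d * (1 + d) ^ 2 * (2 + d))).of_norm_bounded
      fun m => ?_
    rw [norm_mul, hc, one_mul, Complex.norm_real, hg, hg]
    exact abs_inv_one_add_sq_sub_le (norm_nonneg _) (norm_nonneg _) (freq_add_single_le a k m)
  have h1 := hsum.hasSum.comp (tendsto_dualBall a ha k)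
  have h2 : Tendsto (fun r => ∑ m ∈ dualBall a ha k r, c (m + ![1, 0]) * (g (m + ![1, 0]) : ℂ) -
      ∑ m ∈ dualBall a ha k r, c m * (g m : ℂ)) atTop (𝓝 0) := by
    have h3 := (tendsto_sum_annulus a ha k d).const_mul 2
    simp only [mul_zero, ← hg] at h3
    refine squeeze_zero_norm (fun r => ?_) h3
    have hmap : ∑ m ∈ dualBall a ha k r, c (m + ![1, 0]) * (g (m + ![1, 0]) : ℂ) =
        ∑ m ∈ (dualBall a ha k r).map (Equiv.addRight (![1, 0] : Fin 2 → ℤ)).toEmbedding,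
          c m * (g m : ℂ) := by
      rw [Finset.sum_map]
      rfl
    rw [hmap]
    have hd0 : 0 ≤ d := norm_nonneg _
    refine norm_sum_sub_sum_le (fun m => ?_) ?_ (monotone_dualBall a ha k (by linarith)) ?_
      (monotone_dualBall a ha k (by linarith))
    · rw [norm_mul, hc, one_mul, Complex.norm_real, Real.norm_of_nonneg (hg0 m)]
    · intro m hm
      refine Finset.mem_map.2 ⟨m - ![1, 0], mem_dualBall.2 ?_, ?_⟩
      · have h4 := (abs_le.1 (freq_add_single_le a k (m - ![1, 0]))).2
        rw [sub_add_cancel] at h4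
        have h5 := mem_dualBall.1 hm
        linarith
      · exact sub_add_cancel m _
    · intro m hm
      obtain ⟨n, hn, rfl⟩ := Finset.mem_map.1 hm
      have h4 := (abs_le.1 (freq_add_single_le a k n)).1
      have h5 := mem_dualBall.1 hn
      have h6 : freq a k (n + ![1, 0]) ≤ r + d := by linarith
      exact mem_dualBall.2 h6
  have h3 : ω - 1 ≠ 0 := sub_ne_zero.2 hω
  have h4 : ∀ r, ∑ m ∈ dualBall a ha k r, c (m + ![1, 0]) * ((g m - g (m + ![1, 0]) : ℝ) : ℂ) +
      (∑ m ∈ dualBall a ha k r, c (m + ![1, 0]) * (g (m + ![1, 0]) : ℂ) -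
        ∑ m ∈ dualBall a ha k r, c m * (g m : ℂ)) =
      (ω - 1) * ∑ m ∈ dualBall a ha k r, c m * (g m : ℂ) := by
    intro r
    rw [← add_sub_assoc, ← Finset.sum_add_distrib, sub_mul, one_mul, Finset.mul_sum]
    congr 1
    refine Finset.sum_congr rfl fun m _ => ?_
    rw [Complex.ofReal_sub, hcω]
    ring
  have h5 := (h1.add h2).const_mul (ω - 1)⁻¹
  simp only [← hg]
  refine ⟨_, h5.congr fun r => ?_⟩
  exact (congrArg ((ω - 1)⁻¹ * ·) (h4 r)).trans (inv_mul_cancel_left₀ h3 _)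

/-- The phase `e^{i (ξ_m + k)·y_j}` at the scatterer `y_j`. -/
abbrev phase (a : ℝ) (k : Plane) (j : Fin 2) (m : Fin 2 → ℤ) : ℂ := planeWave a k m (site a j)

theorem norm_phase (a : ℝ) (k : Plane) (j : Fin 2) (m : Fin 2 → ℤ) : ‖phase a k j m‖ = 1 := by
  rw [phase, planeWave, mul_comm, Complex.norm_exp_ofReal_mul_I]

theorem phase_mul_conj (a : ℝ) (k : Plane) (j : Fin 2) (m : Fin 2 → ℤ) :
    phase a k j m * starRingEnd ℂ (phase a k j m) = 1 := by
  rw [mul_comm]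
  exact norm_exp_I_mul_sq _

theorem phase_add_single (a : ℝ) (k : Plane) (j : Fin 2) (m : Fin 2 → ℤ) :
    phase a k j (m + ![1, 0]) =
      Complex.exp (Complex.I * (inner ℝ (k₁ a) (site a j) : ℝ)) * phase a k j m := by
  have h : dualVec a (m + ![1, 0]) + k = k₁ a + (dualVec a m + k) := by
    simp only [dualVec, Pi.add_apply, Matrix.cons_val_zero, Matrix.cons_val_one, Int.cast_add,
      Int.cast_one, add_smul, one_smul, Int.cast_zero, zero_smul]
    abel
  rw [phase, phase, planeWave, planeWave, h, inner_add_left, ← Complex.exp_add]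
  push_cast
  ring_nf

theorem exp_four_pi_div_three_ne_one : Complex.exp (Complex.I * (4 * Real.pi / 3 : ℝ)) ≠ 1 := by
  rw [Ne, Complex.exp_eq_one_iff]
  rintro ⟨n, hn⟩
  have h1 : ((4 * Real.pi / 3 : ℝ) : ℂ) = ((n * (2 * Real.pi) : ℝ) : ℂ) := by
    apply mul_left_cancel₀ Complex.I_ne_zero
    rw [hn]
    push_cast
    ring
  have h2 := Complex.ofReal_injective h1
  have h3 := Real.pi_pos
  have h4 : (3 * n : ℝ) = 2 := by nlinarith
  norm_cast at h4
  omega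

theorem inner_k₁_site_zero (a : ℝ) : inner ℝ (k₁ a) (site a 0) = 0 := by
  simp [site]

theorem inner_k₁_site_one (a : ℝ) (ha : 0 < a) :
    inner ℝ (k₁ a) (site a 1) = 4 * Real.pi / 3 := by
  obtain ⟨h11, h12, h21, h22⟩ := inner_k_v a ha
  simp only [site, Matrix.cons_val_one, Matrix.cons_val_zero, real_inner_smul_right,
    inner_add_right, h11, h12]
  ring

theorem exists_tendsto_green (a : ℝ) (ha : 0 < a) (k : Plane) (j l : Fin 2) :
    ∃ Q : ℂ, Tendsto (fun r : ℝ => ∑ m ∈ dualBall a ha k r,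
      phase a k j m * starRingEnd ℂ (phase a k l m) * ((1 + freq a k m ^ 2)⁻¹ : ℝ) -
        ((volume.real (cell a) : ℝ) : ℂ) *
          (if j = l then ((Real.log r / (2 * Real.pi) : ℝ) : ℂ) else 0)) atTop (𝓝 Q) := by
  by_cases hjl : j = l
  · subst hjl
    obtain ⟨A, hA⟩ := exists_tendsto_sum_diagonal a ha k
    refine ⟨A, ((Complex.continuous_ofReal.tendsto A).comp hA).congr fun r => ?_⟩
    simp only [Function.comp_apply, phase_mul_conj, one_mul, if_true]
    push_cast
    ring
  · simp only [if_neg hjl, mul_zero, sub_zero]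
    refine exists_tendsto_sum_oscillating a ha k (c := fun m =>
      phase a k j m * starRingEnd ℂ (phase a k l m))
      (ω := Complex.exp (Complex.I * (inner ℝ (k₁ a) (site a j) : ℝ)) *
        starRingEnd ℂ (Complex.exp (Complex.I * (inner ℝ (k₁ a) (site a l) : ℝ))))
      (fun m => ?_) ?_ fun m => ?_
    · rw [norm_mul, RCLike.norm_conj, norm_phase, norm_phase, one_mul]
    · have h1 := exp_four_pi_div_three_ne_one
      fin_cases j <;> fin_cases l
      · exact absurd rfl hjl
      · intro h
        apply h1
        simp only [Fin.zero_eta, Fin.mk_one, inner_k₁_site_zero, inner_k₁_site_one a ha,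
          Complex.ofReal_zero, mul_zero, Complex.exp_zero, one_mul] at h
        simpa using congrArg (starRingEnd ℂ) h
      · intro h
        apply h1
        simpa only [Fin.zero_eta, Fin.mk_one, inner_k₁_site_zero, inner_k₁_site_one a ha,
          Complex.ofReal_zero, mul_zero, Complex.exp_zero, mul_one, map_one] using h
      · exact absurd rfl hjl
    · simp only [phase_add_single, map_mul]
      ring

/-! ### Functions with point charges -/

/-- The triples `(ψ, η, q)` with `-Δ ψ = η + ∑_j q_j δ_{y_j}`. -/
def chargeSpace (a : ℝ) (k : Plane) : Submodule ℂ (L2 a × L2 a × (Fin 2 → ℂ)) where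
  carrier := {u | ∀ m, ((freq a k m ^ 2 : ℝ) : ℂ) * coeff a k m u.1 =
    coeff a k m u.2.1 + ((volume.real (cell a) : ℝ) : ℂ)⁻¹ *
      ∑ j, u.2.2 j * starRingEnd ℂ (phase a k j m)}
  zero_mem' := by intro m; simp [coeff_zero]
  add_mem' := by
    intro u v hu hv m
    simp only [Prod.fst_add, Prod.snd_add, coeff_add, mul_add, hu m, hv m, Pi.add_apply,
      add_mul, Finset.sum_add_distrib]
    ring
  smul_mem' := by
    intro c u hu m
    simp only [Prod.smul_fst, Prod.smul_snd, coeff_smul, Pi.smul_apply, smul_eq_mul]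
    rw [mul_left_comm, hu m]
    simp only [Fin.sum_univ_two]
    ring

/-- The function `ψ` of a triple `(ψ, η, q)`. -/
def psi (a : ℝ) (k : Plane) : chargeSpace a k →ₗ[ℂ] L2 a :=
  LinearMap.fst ℂ _ _ ∘ₗ (chargeSpace a k).subtype

/-- The regular part `η` of `-Δ ψ`. -/
def eta (a : ℝ) (k : Plane) : chargeSpace a k →ₗ[ℂ] L2 a :=
  LinearMap.fst ℂ _ _ ∘ₗ LinearMap.snd ℂ _ _ ∘ₗ (chargeSpace a k).subtype

/-- The charges `q`. -/
def charge (a : ℝ) (k : Plane) : chargeSpace a k →ₗ[ℂ] (Fin 2 → ℂ) :=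
  LinearMap.snd ℂ _ _ ∘ₗ LinearMap.snd ℂ _ _ ∘ₗ (chargeSpace a k).subtype

theorem chargeSpace_ext {a : ℝ} {k : Plane} {u v : chargeSpace a k} (h1 : psi a k u = psi a k v)
    (h2 : eta a k u = eta a k v) (h3 : charge a k u = charge a k v) : u = v :=
  Subtype.ext (Prod.ext h1 (Prod.ext h2 h3))

theorem chargeSpace_eq {a : ℝ} {k : Plane} (u : chargeSpace a k) (m : Fin 2 → ℤ) :
    ((freq a k m ^ 2 : ℝ) : ℂ) * coeff a k m (psi a k u) =
      coeff a k m (eta a k u) + ((volume.real (cell a) : ℝ) : ℂ)⁻¹ *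
        ∑ j, charge a k u j * starRingEnd ℂ (phase a k j m) := u.2 m

theorem cutoffValue_eq_sum (a : ℝ) (ha : 0 < a) (k : Plane) (r : ℝ) (f : L2 a) (j : Fin 2) :
    cutoffValue a k r f (site a j) =
      ∑ m ∈ dualBall a ha k r, coeff a k m f * phase a k j m :=
  finsum_mem_eq_finite_toFinset_sum _ (finite_dual_ball a ha k r)

/-- The renormalized value at `y_j` with momentum cutoff `r`. -/
def regValue (a : ℝ) (k : Plane) (r : ℝ) (j : Fin 2) (u : chargeSpace a k) : ℂ :=
  cutoffValue a k r (psi a k u) (site a j) -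
    ((Real.log r / (2 * Real.pi) : ℝ) : ℂ) * charge a k u j

theorem coeff_psi_eq {a : ℝ} {k : Plane} (u : chargeSpace a k) (m : Fin 2 → ℤ) :
    coeff a k m (psi a k u) =
      (coeff a k m (eta a k u + psi a k u) + ((volume.real (cell a) : ℝ) : ℂ)⁻¹ *
        ∑ j, charge a k u j * starRingEnd ℂ (phase a k j m)) *
          ((1 + freq a k m ^ 2 : ℝ)⁻¹ : ℝ) := by
  have h : (1 + freq a k m ^ 2 : ℝ) ≠ 0 := by positivity
  have h' : ((1 + freq a k m ^ 2 : ℝ) : ℂ) ≠ 0 := Complex.ofReal_ne_zero.2 h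
  rw [Complex.ofReal_inv, eq_mul_inv_iff_mul_eq₀ h', coeff_add, add_right_comm,
    ← chargeSpace_eq u m]
  push_cast
  ring

theorem exists_tendsto_regValue (a : ℝ) (ha : 0 < a) (k : Plane) (j : Fin 2)
    (u : chargeSpace a k) : ∃ b, Tendsto (fun r => regValue a k r j u) atTop (𝓝 b) := by
  set f := eta a k u + psi a k u with hf
  set s : ℂ := ((volume.real (cell a) : ℝ) : ℂ) with hs
  have hs0 : s ≠ 0 := area_ne_zero a ha
  have hsum : Summable fun m => coeff a k m f * ((1 + freq a k m ^ 2 : ℝ)⁻¹ : ℝ) *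
      phase a k j m := by
    refine ((summable_norm_coeff_sq a ha k f).add (summable_freq_four a ha k)).of_norm_bounded
      fun m => ?_
    rw [norm_mul, norm_mul, norm_phase, mul_one, Complex.norm_real,
      Real.norm_of_nonneg (by positivity), ← inv_pow]
    nlinarith [sq_nonneg (‖coeff a k m f‖ - (1 + freq a k m ^ 2)⁻¹),
      sq_nonneg (‖coeff a k m f‖ + (1 + freq a k m ^ 2)⁻¹)]
  have h1 := hsum.hasSum.comp (tendsto_dualBall a ha k)
  choose Q hQ using exists_tendsto_green a ha k j
  have h2 := (tendsto_finsetSum Finset.univ fun l _ => (hQ l).const_mul (charge a k u l)).const_mul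
    s⁻¹
  refine ⟨_, (h1.add h2).congr fun r => ?_⟩
  rw [regValue, cutoffValue_eq_sum a ha, Function.comp_apply]
  have h3 : ∀ m, coeff a k m (psi a k u) * phase a k j m =
      coeff a k m f * ((1 + freq a k m ^ 2 : ℝ)⁻¹ : ℝ) * phase a k j m +
        s⁻¹ * ∑ l, charge a k u l * (phase a k j m * starRingEnd ℂ (phase a k l m) *
          ((1 + freq a k m ^ 2 : ℝ)⁻¹ : ℝ)) := by
    intro m
    rw [coeff_psi_eq]
    simp only [Fin.sum_univ_two]
    ring
  simp only [h3, Finset.sum_add_distrib, ← Finset.mul_sum]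
  rw [Finset.sum_comm]
  simp only [← Finset.mul_sum, mul_sub, Finset.sum_sub_distrib]
  rw [add_sub_assoc]
  congr 2
  simp only [mul_ite, mul_zero, Finset.sum_ite_eq, Finset.mem_univ, if_true, ← hs]
  field_simp

theorem regValue_add (a : ℝ) (ha : 0 < a) (k : Plane) (r : ℝ) (j : Fin 2)
    (u v : chargeSpace a k) :
    regValue a k r j (u + v) = regValue a k r j u + regValue a k r j v := by
  simp only [regValue, map_add, cutoffValue_add a ha, Pi.add_apply]
  ring

theorem regValue_smul (a : ℝ) (k : Plane) (r : ℝ) (j : Fin 2) (c : ℂ) (u : chargeSpace a k) :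
    regValue a k r j (c • u) = c * regValue a k r j u := by
  simp only [regValue, map_smul, cutoffValue_smul, Pi.smul_apply, smul_eq_mul]
  ring

/-- The renormalized boundary values at the scatterers. -/
def bdry (a : ℝ) (ha : 0 < a) (k : Plane) : chargeSpace a k →ₗ[ℂ] (Fin 2 → ℂ) where
  toFun u j := (exists_tendsto_regValue a ha k j u).choose
  map_add' u v := by
    funext j
    refine tendsto_nhds_unique (exists_tendsto_regValue a ha k j (u + v)).choose_spec ?_
    refine ((exists_tendsto_regValue a ha k j u).choose_spec.add
      (exists_tendsto_regValue a ha k j v).choose_spec).congr fun r => ?_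
    rw [regValue_add a ha]
  map_smul' c u := by
    funext j
    refine tendsto_nhds_unique (exists_tendsto_regValue a ha k j (c • u)).choose_spec ?_
    refine ((exists_tendsto_regValue a ha k j u).choose_spec.const_mul c).congr fun r => ?_
    rw [regValue_smul]

theorem tendsto_bdry (a : ℝ) (ha : 0 < a) (k : Plane) (j : Fin 2) (u : chargeSpace a k) :
    Tendsto (fun r => regValue a k r j u) atTop (𝓝 (bdry a ha k u j)) :=
  (exists_tendsto_regValue a ha k j u).choose_spec

theorem eq_zero_of_psi_eq_zero (a : ℝ) (ha : 0 < a) (k : Plane) {u : chargeSpace a k}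
    (h : psi a k u = 0) : u = 0 := by
  have hq : charge a k u = 0 := by
    funext j
    by_contra hj
    have h1 := (tendsto_bdry a ha k j u).norm
    have h2 : Tendsto (fun r : ℝ => Real.log r / (2 * Real.pi) * ‖charge a k u j‖) atTop atTop :=
      (Real.tendsto_log_atTop.atTop_div_const (by positivity)).atTop_mul_const (norm_pos_iff.2 hj)
    refine not_tendsto_nhds_of_tendsto_atTop h2 _ (h1.congr' ?_)
    filter_upwards [eventually_ge_atTop 1] with r hr
    rw [regValue, h, cutoffValue_eq_sum a ha]
    simp only [coeff_zero, zero_mul, Finset.sum_const_zero, zero_sub, norm_neg, norm_mul,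
      Complex.norm_real]
    rw [Real.norm_of_nonneg (div_nonneg (Real.log_nonneg hr) (by positivity))]
  refine chargeSpace_ext (h.trans (map_zero _).symm) ?_ (hq.trans (map_zero _).symm)
  rw [map_zero]
  refine coeff_ext a ha k fun m => ?_
  have h1 := chargeSpace_eq u m
  rw [h, hq] at h1
  simpa [coeff_zero] using h1.symm

theorem green_identity (a : ℝ) (ha : 0 < a) (k : Plane) (u v : chargeSpace a k) :
    inner ℂ (eta a k u) (psi a k v) - inner ℂ (psi a k u) (eta a k v) =
      ∑ j, (starRingEnd ℂ (bdry a ha k u j) * charge a k v j -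
        starRingEnd ℂ (charge a k u j) * bdry a ha k v j) := by
  have h1 := ((hasSum_inner a ha k (eta a k u) (psi a k v)).sub
    (hasSum_inner a ha k (psi a k u) (eta a k v))).comp (tendsto_dualBall a ha k)
  have h2 : Tendsto (fun r => ∑ j, (starRingEnd ℂ (regValue a k r j u) * charge a k v j -
      starRingEnd ℂ (charge a k u j) * regValue a k r j v)) atTop
      (𝓝 (∑ j, (starRingEnd ℂ (bdry a ha k u j) * charge a k v j -
        starRingEnd ℂ (charge a k u j) * bdry a ha k v j))) := by
    refine tendsto_finsetSum _ fun j _ => ?_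
    exact (((Complex.continuous_conj.tendsto _).comp (tendsto_bdry a ha k j u)).mul_const _).sub
      ((tendsto_bdry a ha k j v).const_mul _)
  refine tendsto_nhds_unique h1 (h2.congr fun r => ?_)
  have hs0 : ((volume.real (cell a) : ℝ) : ℂ) ≠ 0 := area_ne_zero a ha
  have h3 : ∀ m, ((volume.real (cell a) : ℝ) : ℂ) * (starRingEnd ℂ (coeff a k m (eta a k u)) *
      coeff a k m (psi a k v)) - ((volume.real (cell a) : ℝ) : ℂ) *
        (starRingEnd ℂ (coeff a k m (psi a k u)) * coeff a k m (eta a k v)) =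
      ∑ j, (starRingEnd ℂ (coeff a k m (psi a k u) * phase a k j m) * charge a k v j -
        starRingEnd ℂ (charge a k u j) * (coeff a k m (psi a k v) * phase a k j m)) := by
    intro m
    have e1 := eq_sub_of_add_eq (chargeSpace_eq u m).symm
    have e2 := eq_sub_of_add_eq (chargeSpace_eq v m).symm
    rw [e1, e2]
    simp only [Fin.sum_univ_two, map_sub, map_mul, map_add, map_inv₀, Complex.conj_ofReal,
      Complex.conj_conj]
    field_simp
    ring
  rw [Function.comp_apply]
  simp only [h3]
  rw [Finset.sum_comm]
  refine Finset.sum_congr rfl fun j _ => ?_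
  rw [Finset.sum_sub_distrib, ← Finset.mul_sum, ← Finset.sum_mul, ← map_sum,
    ← cutoffValue_eq_sum, ← cutoffValue_eq_sum, regValue, regValue, map_sub, map_mul,
    Complex.conj_ofReal]
  ring

/-! ### The quadratic form -/

/-- The form `⟨η, ψ'⟩ + ⟨α q - β, q'⟩` of the operator with parameter `α`, where `β` are the
renormalized boundary values. -/
def form (a : ℝ) (ha : 0 < a) (k : Plane) (α : ℝ) :
    chargeSpace a k →ₗ⋆[ℂ] chargeSpace a k →ₗ[ℂ] ℂ :=
  LinearMap.mk₂'ₛₗ (starRingEnd ℂ) (RingHom.id ℂ)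
    (fun u v => inner ℂ (eta a k u) (psi a k v) +
      ∑ j, starRingEnd ℂ (α * charge a k u j - bdry a ha k u j) * charge a k v j)
    (fun u u' v => by simp [inner_add_left]; ring)
    (fun c u v => by simp [inner_smul_left]; ring)
    (fun u v v' => by simp [inner_add_right]; ring)
    (fun c u v => by simp [inner_smul_right]; ring)

theorem form_apply (a : ℝ) (ha : 0 < a) (k : Plane) (α : ℝ) (u v : chargeSpace a k) :
    form a ha k α u v = inner ℂ (eta a k u) (psi a k v) +
      ∑ j, starRingEnd ℂ (α * charge a k u j - bdry a ha k u j) * charge a k v j := rfl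

theorem form_symm (a : ℝ) (ha : 0 < a) (k : Plane) (α : ℝ) (u v : chargeSpace a k) :
    form a ha k α u v = starRingEnd ℂ (form a ha k α v u) := by
  have h := green_identity a ha k u v
  rw [form_apply, form_apply, map_add, inner_conj_symm, sub_eq_iff_eq_add.1 h]
  simp only [Fin.sum_univ_two, map_add, map_sub, map_mul, Complex.conj_ofReal, Complex.conj_conj]
  ring

theorem re_form_sub (a : ℝ) (ha : 0 < a) (k : Plane) (α α' : ℝ) (u : chargeSpace a k) :
    (form a ha k α u u).re = (form a ha k α' u u).re + (α - α') * ∑ j, ‖charge a k u j‖ ^ 2 := by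
  have h : form a ha k α u u = form a ha k α' u u +
      ((α - α' : ℝ) * (∑ j, ‖charge a k u j‖ ^ 2 : ℝ) : ℝ) := by
    rw [form_apply, form_apply]
    push_cast
    simp only [Fin.sum_univ_two, map_sub, map_mul, Complex.conj_ofReal, ← Complex.conj_mul']
    ring
  rw [h, Complex.add_re, Complex.ofReal_re]

theorem form_nonneg_of_charge_eq_zero (a : ℝ) (ha : 0 < a) (k : Plane) (α : ℝ)
    {u : chargeSpace a k} (hu : charge a k u = 0) : 0 ≤ (form a ha k α u u).re := by
  rw [form_apply, hu]
  simp only [Pi.zero_apply, mul_zero, Finset.sum_const_zero, add_zero]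
  have h := Complex.hasSum_re (hasSum_inner a ha k (eta a k u) (psi a k u))
  refine h.nonneg fun m => ?_
  have e1 := chargeSpace_eq u m
  rw [hu] at e1
  simp only [Pi.zero_apply, zero_mul, Finset.sum_const_zero, mul_zero, add_zero] at e1
  rw [← e1, map_mul, Complex.conj_ofReal, mul_assoc, ← Complex.normSq_eq_conj_mul_self,
    ← Complex.ofReal_mul, ← Complex.ofReal_mul, Complex.ofReal_re]
  exact mul_nonneg (area_pos a ha).le (mul_nonneg (by positivity) (Complex.normSq_nonneg _))

/-- `g q` are the functions with charge `q` in the kernel of `-Δ + c` away from the scatterers. -/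
structure IsGreenMap (a : ℝ) (k : Plane) (c : ℝ) (g : (Fin 2 → ℂ) →ₗ[ℂ] chargeSpace a k) :
    Prop where
  charge_eq : ∀ q, charge a k (g q) = q
  eta_eq : ∀ q, eta a k (g q) = -(c : ℂ) • psi a k (g q)

theorem IsGreenMap.coeff_psi {a : ℝ} {k : Plane} {c : ℝ}
    {g : (Fin 2 → ℂ) →ₗ[ℂ] chargeSpace a k} (hg : IsGreenMap a k c g) (hc : 0 < c)
    (q : Fin 2 → ℂ) (m : Fin 2 → ℤ) : coeff a k m (psi a k (g q)) =
      ((volume.real (cell a) : ℝ) : ℂ)⁻¹ * (∑ j, q j * starRingEnd ℂ (phase a k j m)) *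
        ((freq a k m ^ 2 + c : ℝ)⁻¹ : ℝ) := by
  have h : (freq a k m ^ 2 + c : ℝ) ≠ 0 := by positivity
  have h' : ((freq a k m ^ 2 + c : ℝ) : ℂ) ≠ 0 := Complex.ofReal_ne_zero.2 h
  have h1 := chargeSpace_eq (g q) m
  rw [hg.charge_eq, hg.eta_eq, coeff_smul] at h1
  rw [Complex.ofReal_inv, eq_mul_inv_iff_mul_eq₀ h', ← sub_eq_iff_eq_add'.2 h1]
  push_cast
  ring

theorem inv_freq_add_le (a : ℝ) (k : Plane) (m : Fin 2 → ℤ) {c : ℝ} (hc : 1 ≤ c) :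
    (freq a k m ^ 2 + c)⁻¹ ≤ (1 + freq a k m ^ 2)⁻¹ :=
  inv_anti₀ (by positivity) (by linarith)

theorem exists_isGreenMap (a : ℝ) (ha : 0 < a) (k : Plane) {c : ℝ} (hc : 1 ≤ c) :
    ∃ g, IsGreenMap a k c g := by
  have hc0 : 0 < c := by linarith
  have h1 : ∀ j : Fin 2, ∃ f : L2 a, ∀ m, coeff a k m f =
      ((volume.real (cell a) : ℝ) : ℂ)⁻¹ * starRingEnd ℂ (phase a k j m) *
        ((freq a k m ^ 2 + c : ℝ)⁻¹ : ℝ) := by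
    intro j
    refine exists_coeff_eq a ha k ?_
    refine ((summable_freq_four a ha k).mul_left
      (‖((volume.real (cell a) : ℝ) : ℂ)⁻¹‖ ^ 2)).of_nonneg_of_le (fun m => by positivity)
      fun m => ?_
    rw [norm_mul, norm_mul, RCLike.norm_conj, norm_phase, mul_one, mul_pow, Complex.norm_real,
      Real.norm_of_nonneg (by positivity), ← inv_pow]
    exact mul_le_mul_of_nonneg_left
      (pow_le_pow_left₀ (by positivity) (inv_freq_add_le a k m hc) 2) (by positivity)
  choose f hf using h1
  have hmem : ∀ j, ((f j, -(c : ℂ) • f j, Pi.single j 1) : L2 a × L2 a × (Fin 2 → ℂ)) ∈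
      chargeSpace a k := by
    intro j m
    have h : (freq a k m ^ 2 + c : ℝ) ≠ 0 := by positivity
    have h' : ((freq a k m ^ 2 + c : ℝ) : ℂ) ≠ 0 := Complex.ofReal_ne_zero.2 h
    have hs0 : ((volume.real (cell a) : ℝ) : ℂ) ≠ 0 := area_ne_zero a ha
    have h2 : ∑ l, (Pi.single j 1 : Fin 2 → ℂ) l * starRingEnd ℂ (phase a k l m) =
        starRingEnd ℂ (phase a k j m) := by
      simp [Pi.single_apply]
    simp only [coeff_smul, h2]
    rw [← sub_eq_iff_eq_add', neg_mul, sub_neg_eq_add, ← add_mul, hf, mul_comm, mul_assoc,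
      ← Complex.ofReal_add, Complex.ofReal_inv, inv_mul_cancel₀ h', mul_one]
  refine ⟨Fintype.linearCombination ℂ fun j => (⟨_, hmem j⟩ : chargeSpace a k), ?_, ?_⟩
  · intro q
    have h3 : ∀ j, charge a k ⟨_, hmem j⟩ = Pi.single j 1 := fun j => rfl
    simp only [Fintype.linearCombination_apply, map_sum, map_smul, h3]
    funext l
    fin_cases l <;> simp
  · intro q
    simp only [Fintype.linearCombination_apply, map_sum, map_smul, Finset.smul_sum]
    refine Finset.sum_congr rfl fun j _ => ?_
    rw [smul_comm]
    rfl

theorem IsGreenMap.re_form_add {a : ℝ} {ha : 0 < a} {k : Plane} {c : ℝ}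
    {g : (Fin 2 → ℂ) →ₗ[ℂ] chargeSpace a k} (hg : IsGreenMap a k c g) (α : ℝ)
    {v : chargeSpace a k} (hv : charge a k v = 0) (q : Fin 2 → ℂ) :
    (form a ha k α (v + g q) (v + g q)).re + c * ‖psi a k (v + g q)‖ ^ 2 =
      (form a ha k α v v).re + c * ‖psi a k v‖ ^ 2 + α * ∑ j, ‖q j‖ ^ 2 -
        (∑ j, starRingEnd ℂ (bdry a ha k (g q) j) * q j).re := by
  have hgw : ∀ w, shiftForm (form a ha k α) (psi a k) c (g q) w =
      ∑ j, starRingEnd ℂ (α * q j - bdry a ha k (g q) j) * charge a k w j := by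
    intro w
    rw [shiftForm_apply, form_apply, hg.eta_eq, hg.charge_eq, inner_smul_left, map_neg,
      Complex.conj_ofReal]
    ring
  have h1 : shiftForm (form a ha k α) (psi a k) c (g q) v = 0 := by
    rw [hgw, hv]
    simp
  have h2 : shiftForm (form a ha k α) (psi a k) c v (g q) = 0 := by
    have h3 := congrArg (starRingEnd ℂ) h1
    rw [shiftForm_apply, map_add, ← form_symm, map_mul, Complex.conj_ofReal, inner_conj_symm,
      map_zero] at h3
    exact h3
  have h4 : shiftForm (form a ha k α) (psi a k) c (g q) (g q) =
      ((α * ∑ j, ‖q j‖ ^ 2 : ℝ) : ℂ) - ∑ j, starRingEnd ℂ (bdry a ha k (g q) j) * q j := by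
    rw [hgw, hg.charge_eq]
    push_cast
    simp only [Fin.sum_univ_two, map_sub, map_mul, Complex.conj_ofReal, ← Complex.conj_mul']
    ring
  rw [← re_shiftForm_self, ← re_shiftForm_self]
  simp only [map_add, LinearMap.add_apply, h1, h2, h4, zero_add, add_zero, Complex.add_re,
    Complex.sub_re, Complex.ofReal_re]
  ring

theorem IsGreenMap.charge_sub {a : ℝ} {k : Plane} {c : ℝ}
    {g : (Fin 2 → ℂ) →ₗ[ℂ] chargeSpace a k} (hg : IsGreenMap a k c g) (u : chargeSpace a k) :
    charge a k (u - g (charge a k u)) = 0 := by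
  rw [map_sub, hg.charge_eq, sub_self]

theorem norm_quadratic_le {B : Fin 2 → Fin 2 → ℂ} {K : ℝ} (hB : ∀ j l, ‖B j l‖ ≤ K)
    (q : Fin 2 → ℂ) : ‖∑ j, starRingEnd ℂ (∑ l, q l * B j l) * q j‖ ≤ 2 * K * ∑ j, ‖q j‖ ^ 2 := by
  have hK : 0 ≤ K := (norm_nonneg _).trans (hB 0 0)
  have h1 : ∀ j, ‖starRingEnd ℂ (∑ l, q l * B j l) * q j‖ ≤
      ((‖q 0‖ + ‖q 1‖) * K) * ‖q j‖ := by
    intro j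
    rw [norm_mul, RCLike.norm_conj, Fin.sum_univ_two, add_mul]
    refine mul_le_mul_of_nonneg_right ((norm_add_le _ _).trans ?_) (norm_nonneg _)
    rw [norm_mul, norm_mul]
    exact add_le_add (mul_le_mul_of_nonneg_left (hB j 0) (norm_nonneg _))
      (mul_le_mul_of_nonneg_left (hB j 1) (norm_nonneg _))
  refine (norm_sum_le_of_le _ fun j _ => h1 j).trans ?_
  rw [Fin.sum_univ_two, Fin.sum_univ_two]
  nlinarith [mul_nonneg hK (sq_nonneg (‖q 0‖ - ‖q 1‖))]

theorem map_eq_sum_single {E : Type*} [AddCommGroup E] [Module ℂ E] (T : (Fin 2 → ℂ) →ₗ[ℂ] E)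
    (q : Fin 2 → ℂ) : T q = ∑ l, q l • T (Pi.single l 1) := by
  conv_lhs => rw [← LinearMap.sum_single_apply (fun _ => ℂ) q]
  rw [map_sum]
  refine Finset.sum_congr rfl fun l _ => ?_
  rw [← map_smul, ← Pi.single_smul]
  simp

theorem exists_norm_quadratic_le (T : (Fin 2 → ℂ) →ₗ[ℂ] (Fin 2 → ℂ)) :
    ∃ K, 0 ≤ K ∧ ∀ q, ‖∑ j, starRingEnd ℂ (T q j) * q j‖ ≤ K * ∑ j, ‖q j‖ ^ 2 := by
  set K := ∑ j, ∑ l, ‖T (Pi.single l 1) j‖ with hK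
  refine ⟨2 * K, by positivity, fun q => ?_⟩
  have h := norm_quadratic_le (B := fun j l => T (Pi.single l 1) j) (K := K) (fun j l => ?_) q
  · refine le_trans (le_of_eq ?_) h
    congr 1
    refine Finset.sum_congr rfl fun j _ => ?_
    rw [map_eq_sum_single T q]
    simp
  · refine le_trans ?_ (Finset.single_le_sum (f := fun j => ∑ l, ‖T (Pi.single l 1) j‖)
      (fun _ _ => by positivity) (Finset.mem_univ j))
    exact Finset.single_le_sum (f := fun l => ‖T (Pi.single l 1) j‖)
      (fun _ _ => norm_nonneg _) (Finset.mem_univ l)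

theorem exists_norm_sq_le {E : Type*} [NormedAddCommGroup E] [NormedSpace ℂ E]
    (T : (Fin 2 → ℂ) →ₗ[ℂ] E) : ∃ K, 0 ≤ K ∧ ∀ q, ‖T q‖ ^ 2 ≤ K * ∑ j, ‖q j‖ ^ 2 := by
  set K := ‖T (Pi.single 0 1)‖ + ‖T (Pi.single 1 1)‖ with hK
  refine ⟨2 * K ^ 2, by positivity, fun q => ?_⟩
  have h1 : ‖T q‖ ≤ K * (‖q 0‖ + ‖q 1‖) := by
    rw [map_eq_sum_single T q, Fin.sum_univ_two]
    refine (norm_add_le _ _).trans ?_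
    rw [norm_smul, norm_smul]
    nlinarith [norm_nonneg (q 0), norm_nonneg (q 1), norm_nonneg (T (Pi.single 0 1)),
      norm_nonneg (T (Pi.single 1 1)),
      mul_nonneg (norm_nonneg (q 0)) (norm_nonneg (T (Pi.single 1 1))),
      mul_nonneg (norm_nonneg (q 1)) (norm_nonneg (T (Pi.single 0 1)))]
  have h2 := pow_le_pow_left₀ (norm_nonneg _) h1 2
  rw [Fin.sum_univ_two]
  nlinarith [mul_nonneg (sq_nonneg K) (sq_nonneg (‖q 0‖ - ‖q 1‖))]

theorem IsGreenMap.sum_regValue {a : ℝ} (ha : 0 < a) {k : Plane} {c : ℝ}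
    {g : (Fin 2 → ℂ) →ₗ[ℂ] chargeSpace a k} (hg : IsGreenMap a k c g) (hc : 0 < c) (r : ℝ)
    (q : Fin 2 → ℂ) : ∑ j, starRingEnd ℂ (regValue a k r j (g q)) * q j =
      ((∑ m ∈ dualBall a ha k r, (volume.real (cell a))⁻¹ *
        ‖∑ j, q j * starRingEnd ℂ (phase a k j m)‖ ^ 2 * (freq a k m ^ 2 + c)⁻¹ -
          Real.log r / (2 * Real.pi) * ∑ j, ‖q j‖ ^ 2 : ℝ) : ℂ) := by
  have h1 : ∑ j, starRingEnd ℂ (regValue a k r j (g q)) * q j =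
      ∑ m ∈ dualBall a ha k r, starRingEnd ℂ (coeff a k m (psi a k (g q))) *
        (∑ j, q j * starRingEnd ℂ (phase a k j m)) -
          ((Real.log r / (2 * Real.pi) : ℝ) : ℂ) * ∑ j, starRingEnd ℂ (q j) * q j := by
    simp only [regValue, cutoffValue_eq_sum a ha, hg.charge_eq, Fin.sum_univ_two, map_sub, map_sum,
      map_mul, Complex.conj_ofReal, mul_add, Finset.sum_add_distrib, sub_mul, Finset.sum_mul]
    have h2 : ∀ j, ∑ m ∈ dualBall a ha k r, starRingEnd ℂ (coeff a k m (psi a k (g q))) *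
        starRingEnd ℂ (phase a k j m) * q j = ∑ m ∈ dualBall a ha k r,
          starRingEnd ℂ (coeff a k m (psi a k (g q))) * (q j * starRingEnd ℂ (phase a k j m)) :=
      fun j => Finset.sum_congr rfl fun m _ => by ring
    rw [h2, h2]
    ring
  rw [h1]
  push_cast
  simp only [Complex.conj_mul']
  congr 1
  refine Finset.sum_congr rfl fun m _ => ?_
  rw [hg.coeff_psi hc, map_mul, map_mul, map_inv₀, Complex.conj_ofReal, Complex.conj_ofReal,
    ← Complex.conj_mul']
  push_cast
  ring

theorem tendsto_log_div_atTop :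
    Tendsto (fun r : ℝ => Real.log r / (2 * Real.pi)) atTop atTop :=
  Real.tendsto_log_atTop.atTop_div_const (by positivity)

theorem tendsto_sum_regValue (a : ℝ) (ha : 0 < a) (k : Plane) (u : chargeSpace a k)
    (q : Fin 2 → ℂ) : Tendsto (fun r => ∑ j, starRingEnd ℂ (regValue a k r j u) * q j) atTop
      (𝓝 (∑ j, starRingEnd ℂ (bdry a ha k u j) * q j)) :=
  tendsto_finsetSum _ fun j _ =>
    ((Complex.continuous_conj.tendsto _).comp (tendsto_bdry a ha k j u)).mul_const _

theorem exists_bdry_le (a : ℝ) (ha : 0 < a) (k : Plane) (M : ℝ) :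
    ∃ c, 1 ≤ c ∧ ∀ g, IsGreenMap a k c g → ∀ q,
      (∑ j, starRingEnd ℂ (bdry a ha k (g q) j) * q j).re ≤ -M * ∑ j, ‖q j‖ ^ 2 := by
  obtain ⟨g₁, hg₁⟩ := exists_isGreenMap a ha k le_rfl
  set A := volume.real (cell a) with hA
  have hA0 : 0 < A := area_pos a ha
  set N : ℝ → ℝ → (Fin 2 → ℂ) → ℝ := fun c r q =>
    ∑ m ∈ dualBall a ha k r, A⁻¹ * ‖∑ j, q j * starRingEnd ℂ (phase a k j m)‖ ^ 2 *
      (freq a k m ^ 2 + c)⁻¹ - Real.log r / (2 * Real.pi) * ∑ j, ‖q j‖ ^ 2 with hN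
  obtain ⟨K, hK⟩ : ∃ K, ∀ᶠ r in atTop, ∀ q, |N 1 r q| ≤ K * ∑ j, ‖q j‖ ^ 2 := by
    have hb : ∃ K, ∀ᶠ r in atTop, ∀ j l, ‖regValue a k r j (g₁ (Pi.single l 1))‖ ≤ K := by
      refine ⟨∑ j, ∑ l, (‖bdry a ha k (g₁ (Pi.single l 1)) j‖ + 1), ?_⟩
      rw [eventually_all]
      intro j
      rw [eventually_all]
      intro l
      filter_upwards [(tendsto_bdry a ha k j (g₁ (Pi.single l 1))).norm.eventually
        (eventually_le_nhds (lt_add_one _))] with r hr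
      refine hr.trans ?_
      refine le_trans ?_ (Finset.single_le_sum
        (f := fun j => ∑ l, (‖bdry a ha k (g₁ (Pi.single l 1)) j‖ + 1))
        (fun _ _ => by positivity) (Finset.mem_univ j))
      exact Finset.single_le_sum (f := fun l => ‖bdry a ha k (g₁ (Pi.single l 1)) j‖ + 1)
        (fun _ _ => by positivity) (Finset.mem_univ l)
    obtain ⟨K, hK⟩ := hb
    refine ⟨2 * K, hK.mono fun r hr q => ?_⟩
    have h1 := norm_quadratic_le hr q
    have h2 : ∀ j, ∑ l, q l * regValue a k r j (g₁ (Pi.single l 1)) = regValue a k r j (g₁ q) := by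
      intro j
      rw [map_eq_sum_single g₁ q, Fin.sum_univ_two, Fin.sum_univ_two, regValue_add a ha,
        regValue_smul, regValue_smul]
    simp only [h2] at h1
    rwa [hg₁.sum_regValue ha one_pos, Complex.norm_real, Real.norm_eq_abs] at h1
  obtain ⟨R, hR⟩ := eventually_atTop.1 (hK.and
    (tendsto_log_div_atTop.eventually_ge_atTop (3 * K + 2 * M)))
  set c := R ^ 2 + 2 with hc
  have hc1 : 1 ≤ c := by nlinarith [sq_nonneg R]
  refine ⟨c, hc1, fun g hg q => ?_⟩
  have hS : 0 ≤ ∑ j, ‖q j‖ ^ 2 := by positivity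
  have hlim := (Complex.continuous_re.tendsto _).comp (tendsto_sum_regValue a ha k (g q) q)
  refine le_of_tendsto hlim ?_
  filter_upwards [eventually_ge_atTop R] with r hr
  rw [Function.comp_apply, hg.sum_regValue ha (by linarith), Complex.ofReal_re]
  have h1 := (abs_le.1 ((hR r hr).1 q)).2
  have h2 := (abs_le.1 ((hR R le_rfl).1 q)).1
  have h3 := mul_le_mul_of_nonneg_right (hR R le_rfl).2 hS
  have h4 : ∑ m ∈ dualBall a ha k R, A⁻¹ * ‖∑ j, q j * starRingEnd ℂ (phase a k j m)‖ ^ 2 *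
      (freq a k m ^ 2 + 1)⁻¹ ≤ 2 * ∑ m ∈ dualBall a ha k r,
        (A⁻¹ * ‖∑ j, q j * starRingEnd ℂ (phase a k j m)‖ ^ 2 * (freq a k m ^ 2 + 1)⁻¹ -
          A⁻¹ * ‖∑ j, q j * starRingEnd ℂ (phase a k j m)‖ ^ 2 * (freq a k m ^ 2 + c)⁻¹) := by
    rw [Finset.mul_sum]
    refine le_trans (Finset.sum_le_sum fun m hm => ?_) (Finset.sum_le_sum_of_subset_of_nonneg
      (monotone_dualBall a ha k hr) fun m _ _ => ?_)
    · have h5 : freq a k m ^ 2 ≤ R ^ 2 :=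
        pow_le_pow_left₀ (norm_nonneg _) (mem_dualBall.1 hm) 2
      have h6 : (freq a k m ^ 2 + 1)⁻¹ ≤
          2 * ((freq a k m ^ 2 + 1)⁻¹ - (freq a k m ^ 2 + c)⁻¹) := by
        have h7 : (freq a k m ^ 2 + c)⁻¹ ≤ (2 * (freq a k m ^ 2 + 1))⁻¹ :=
          inv_anti₀ (by positivity) (by linarith)
        rw [mul_inv] at h7
        linarith
      calc _ ≤ A⁻¹ * ‖∑ j, q j * starRingEnd ℂ (phase a k j m)‖ ^ 2 *
            (2 * ((freq a k m ^ 2 + 1)⁻¹ - (freq a k m ^ 2 + c)⁻¹)) := by gcongr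
        _ = _ := by ring
    · rw [← mul_sub]
      have h8 : (freq a k m ^ 2 + c)⁻¹ ≤ (freq a k m ^ 2 + 1)⁻¹ :=
        inv_anti₀ (by positivity) (by linarith)
      have h9 := sub_nonneg.2 h8
      positivity
  rw [Finset.sum_sub_distrib] at h4
  simp only [hN] at h1 h2
  nlinarith

/-! ### The operator and its eigenbasis -/

/-- The boundary condition of the operator with parameter `α` at both scatterers. -/
def IsBdry (a : ℝ) (ha : 0 < a) (k : Plane) (α : WithTop ℝ) (u : chargeSpace a k) : Prop :=
  (α = ⊤ → charge a k u = 0) ∧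
    ∀ b : ℝ, α = (b : WithTop ℝ) → bdry a ha k u = (b : ℂ) • charge a k u

theorem mem_pointScatterer_iff {a : ℝ} {ha : 0 < a} {k : Plane} {α : WithTop ℝ}
    {p : L2 a × L2 a} : p ∈ pointScatterer a ha k (fun _ => α) ↔
      ∃ u : chargeSpace a k, psi a k u = p.1 ∧ eta a k u = p.2 ∧ IsBdry a ha k α u := by
  constructor
  · rintro ⟨q, hq, hb⟩
    refine ⟨⟨(p.1, p.2, q), hq⟩, rfl, rfl, fun h => funext fun j => (hb j).1 h, fun b h => ?_⟩
    funext j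
    exact tendsto_nhds_unique (tendsto_bdry a ha k j _) ((hb j).2 b h)
  · rintro ⟨u, h1, h2, h3⟩
    refine ⟨charge a k u, ?_, fun j => ⟨fun h => congrFun (h3.1 h) j, fun b h => ?_⟩⟩
    · rw [← h1, ← h2]
      exact u.2
    · have h4 := tendsto_bdry a ha k j u
      rw [h3.2 b h] at h4
      rw [← h1]
      exact h4

/-- The form domain: all of `chargeSpace`, or the functions without charges if `α = ∞`. -/
def formDomain (a : ℝ) (k : Plane) (α : WithTop ℝ) : Submodule ℂ (chargeSpace a k) where
  carrier := {u | α = ⊤ → charge a k u = 0}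
  zero_mem' := fun _ => map_zero _
  add_mem' := fun hu hv h => by rw [map_add, hu h, hv h, add_zero]
  smul_mem' := fun c u hu h => by rw [map_smul, hu h, smul_zero]

theorem mem_formDomain_coe {a : ℝ} {k : Plane} {α : ℝ} (u : chargeSpace a k) :
    u ∈ formDomain a k (α : WithTop ℝ) := fun h => absurd h (WithTop.coe_ne_top)

theorem mem_formDomain_of_charge_eq_zero {a : ℝ} {k : Plane} {α : WithTop ℝ}
    {u : chargeSpace a k} (h : charge a k u = 0) : u ∈ formDomain a k α := fun _ => h

theorem IsBdry.mem_formDomain {a : ℝ} {ha : 0 < a} {k : Plane} {α : WithTop ℝ}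
    {u : chargeSpace a k} (hu : IsBdry a ha k α u) : u ∈ formDomain a k α := hu.1

theorem IsBdry.form_eq {a : ℝ} {ha : 0 < a} {k : Plane} {α : WithTop ℝ} {u v : chargeSpace a k}
    (hu : IsBdry a ha k α u) (hv : v ∈ formDomain a k α) :
    form a ha k (α.untopD 0) u v = inner ℂ (eta a k u) (psi a k v) := by
  rw [form_apply]
  induction α using WithTop.recTopCoe with
  | top => simp [hv rfl]
  | coe b => simp [hu.2 b rfl]

theorem pointScatterer_symm (a : ℝ) (ha : 0 < a) (k : Plane) (α : WithTop ℝ) :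
    ∀ p ∈ pointScatterer a ha k (fun _ => α), ∀ p' ∈ pointScatterer a ha k (fun _ => α),
      inner ℂ p.2 p'.1 = inner ℂ p.1 p'.2 := by
  intro p hp p' hp'
  obtain ⟨u, h1, h2, h3⟩ := mem_pointScatterer_iff.1 hp
  obtain ⟨u', h1', h2', h3'⟩ := mem_pointScatterer_iff.1 hp'
  rw [← h1, ← h2, ← h1', ← h2', ← h3.form_eq h3'.mem_formDomain, form_symm,
    h3'.form_eq h3.mem_formDomain, inner_conj_symm]

theorem floquetLaplacian_eq (a : ℝ) (ha : 0 < a) (k : Plane) :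
    floquetLaplacian a k = pointScatterer a ha k (fun _ => ⊤) := by
  ext p
  rw [mem_pointScatterer_iff]
  constructor
  · intro hp
    refine ⟨⟨(p.1, p.2, 0), fun m => ?_⟩, rfl, rfl, fun _ => rfl, fun b h => ?_⟩
    · simpa using (hp m).symm
    · exact absurd h.symm WithTop.coe_ne_top
  · rintro ⟨u, h1, h2, h3⟩ m
    have h4 := chargeSpace_eq u m
    rw [h3.1 rfl] at h4
    simpa [h1, h2] using h4.symm

theorem exists_form_nonneg (a : ℝ) (ha : 0 < a) (k : Plane) (α : ℝ) :
    ∃ c, ∀ u, 0 ≤ (form a ha k α u u).re + c * ‖psi a k u‖ ^ 2 := by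
  obtain ⟨c, hc, hb⟩ := exists_bdry_le a ha k (-α)
  obtain ⟨g, hg⟩ := exists_isGreenMap a ha k hc
  refine ⟨c, fun u => ?_⟩
  have h1 := hg.re_form_add (ha := ha) α (hg.charge_sub u) (charge a k u)
  rw [sub_add_cancel] at h1
  rw [h1]
  have h2 := hb g hg (charge a k u)
  have h3 := form_nonneg_of_charge_eq_zero a ha k α (hg.charge_sub u)
  have h4 : 0 ≤ c * ‖psi a k (u - g (charge a k u))‖ ^ 2 := by positivity
  linarith

theorem tendsto_freq_cofinite (a : ℝ) (ha : 0 < a) (k : Plane) :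
    Tendsto (freq a k) cofinite atTop := by
  refine tendsto_atTop.2 fun r => (finite_dual_ball a ha k r).subset fun m hm => ?_
  exact (not_le.1 (show ¬ r ≤ freq a k m from hm)).le

/-- Eigenvectors `u i` of the operator, with eigenvalues `l i`, that form a Hilbert basis. -/
structure IsEigenbasis (a : ℝ) (ha : 0 < a) (k : Plane) (α : WithTop ℝ) {ι : Type*}
    (e : HilbertBasis ι ℂ (L2 a)) (u : ι → chargeSpace a k) (l : ι → ℝ) : Prop where
  bdry : ∀ i, IsBdry a ha k α (u i)
  psi : ∀ i, psi a k (u i) = e i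
  eta : ∀ i, eta a k (u i) = (l i : ℂ) • e i

theorem IsEigenbasis.formBasis {a : ℝ} {ha : 0 < a} {k : Plane} {α : WithTop ℝ} {ι : Type*}
    {e : HilbertBasis ι ℂ (L2 a)} {u : ι → chargeSpace a k} {l : ι → ℝ}
    (h : IsEigenbasis a ha k α e u l) : FormBasis (form a ha k (α.untopD 0))
      (PointScatterer.psi a k) (formDomain a k α) e u l where
  mem i := (h.bdry i).mem_formDomain
  map := h.psi
  form i w hw := by
    rw [(h.bdry i).form_eq hw, h.eta, inner_smul_left, Complex.conj_ofReal]

theorem IsEigenbasis.mem_graph {a : ℝ} {ha : 0 < a} {k : Plane} {α : WithTop ℝ} {ι : Type*}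
    {e : HilbertBasis ι ℂ (L2 a)} {u : ι → chargeSpace a k} {l : ι → ℝ}
    (h : IsEigenbasis a ha k α e u l) (i : ι) :
    (e i, (l i : ℂ) • e i) ∈ pointScatterer a ha k (fun _ => α) :=
  mem_pointScatterer_iff.2 ⟨u i, h.psi i, h.eta i, h.bdry i⟩

theorem exists_isEigenbasis_top (a : ℝ) (ha : 0 < a) (k : Plane) :
    ∃ u, IsEigenbasis a ha k ⊤ (waveBasis a ha k) u fun m => freq a k m ^ 2 := by
  have hmem : ∀ m, ((waveBasis a ha k m, ((freq a k m ^ 2 : ℝ) : ℂ) • waveBasis a ha k m, 0) :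
      L2 a × L2 a × (Fin 2 → ℂ)) ∈ chargeSpace a k := by
    intro m n
    simp only [coeff_smul, Pi.zero_apply, zero_mul, Finset.sum_const_zero, mul_zero, add_zero]
    by_cases hmn : n = m
    · rw [hmn]
    · have h1 := inner_waveBasis a ha k n (waveBasis a ha k m)
      rw [(waveBasis a ha k).orthonormal.2 hmn] at h1
      have h2 : ((√(volume.real (cell a)) : ℝ) : ℂ) ≠ 0 := by
        rw [Complex.ofReal_ne_zero]
        have := area_pos a ha
        positivity
      rw [(mul_eq_zero.1 h1.symm).resolve_left h2, mul_zero, mul_zero]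
  exact ⟨fun m => ⟨_, hmem m⟩, fun m => ⟨fun _ => rfl, fun b h => absurd h.symm
    WithTop.coe_ne_top⟩, fun m => rfl, fun m => rfl⟩

theorem exists_isEigenbasis_coe (a : ℝ) (ha : 0 < a) (k : Plane) (α : ℝ) :
    ∃ (ι : Type) (e : HilbertBasis ι ℂ (L2 a)) (u : ι → chargeSpace a k) (l : ι → ℝ),
      IsEigenbasis a ha k α e u l := by
  obtain ⟨c, hc, hb⟩ := exists_bdry_le a ha k (1 - α)
  obtain ⟨g, hg⟩ := exists_isGreenMap a ha k hc
  have hd : Tendsto (fun m => (freq a k m ^ 2 + c)⁻¹) cofinite (𝓝 0) :=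
    tendsto_inv_atTop_zero.comp (tendsto_atTop_add_const_right _ c
      ((tendsto_pow_atTop two_ne_zero).comp (tendsto_freq_cofinite a ha k)))
  obtain ⟨R, hRc, hR⟩ := exists_isCompactOperator_diagonal (waveBasis a ha k) _ hd
  have hs : ((√(volume.real (cell a)) : ℝ) : ℂ) ≠ 0 := by
    rw [Complex.ofReal_ne_zero]
    have := area_pos a ha
    positivity
  have hRcoeff : ∀ m f, coeff a k m (R f) = ((freq a k m ^ 2 + c : ℝ)⁻¹ : ℝ) * coeff a k m f := by
    intro m f
    have h1 := hR m f
    rw [inner_waveBasis, inner_waveBasis, mul_left_comm] at h1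
    exact mul_left_cancel₀ hs h1
  have hVmem : ∀ f, ((R f, f - (c : ℂ) • R f, 0) : L2 a × L2 a × (Fin 2 → ℂ)) ∈
      chargeSpace a k := by
    intro f m
    have h : (freq a k m ^ 2 + c : ℝ) ≠ 0 := by positivity
    have h' : ((freq a k m ^ 2 + c : ℝ) : ℂ) ≠ 0 := Complex.ofReal_ne_zero.2 h
    simp only [sub_eq_add_neg, ← neg_smul, coeff_add, coeff_smul, Pi.zero_apply, zero_mul,
      Finset.sum_const_zero, mul_zero, add_zero]
    rw [← sub_eq_iff_eq_add, neg_mul, sub_neg_eq_add, ← add_mul, hRcoeff, ← Complex.ofReal_add,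
      Complex.ofReal_inv, mul_inv_cancel_left₀ h']
  let V : L2 a →ₗ[ℂ] chargeSpace a k :=
    { toFun := fun f => ⟨_, hVmem f⟩
      map_add' := fun f f' => chargeSpace_ext (map_add R f f')
        (show f + f' - (c : ℂ) • R (f + f') = (f - (c : ℂ) • R f) + (f' - (c : ℂ) • R f') by
          rw [map_add, smul_add]; abel) (add_zero (0 : Fin 2 → ℂ)).symm
      map_smul' := fun z f => chargeSpace_ext (map_smul R z f)
        (show z • f - (c : ℂ) • R (z • f) = z • (f - (c : ℂ) • R f) by
          rw [map_smul, smul_sub, smul_comm]) (smul_zero z).symm }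
  have hVpsi : ∀ f, psi a k (V f) = R f := fun f => rfl
  have hVeta : ∀ f, eta a k (V f) = f - (c : ℂ) • R f := fun f => rfl
  have hVcharge : ∀ f, charge a k (V f) = 0 := fun f => rfl
  have hVbdry : ∀ f j, bdry a ha k (V f) j = inner ℂ (psi a k (g (Pi.single j 1))) f := by
    intro f j
    have h1 := green_identity a ha k (g (Pi.single j 1)) (V f)
    rw [hVcharge, hVpsi, hVeta, hg.eta_eq, hg.charge_eq, inner_smul_left, inner_sub_right,
      inner_smul_right, map_neg, Complex.conj_ofReal] at h1
    have h2 : ∑ l, (starRingEnd ℂ (bdry a ha k (g (Pi.single j 1)) l) * (0 : Fin 2 → ℂ) l -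
        starRingEnd ℂ ((Pi.single j 1 : Fin 2 → ℂ) l) * bdry a ha k (V f) l) =
          -bdry a ha k (V f) j := by
      simp [Pi.single_apply]
    rw [h2] at h1
    linear_combination h1
  let Kmap : (Fin 2 → ℂ) →ₗ[ℂ] (Fin 2 → ℂ) := (α : ℂ) • LinearMap.id - bdry a ha k ∘ₗ g
  have hK : ∀ q, Kmap q = (α : ℂ) • q - bdry a ha k (g q) := fun q => rfl
  have hKinj : Function.Injective Kmap := by
    rw [injective_iff_map_eq_zero]
    intro q hq
    rw [hK, sub_eq_zero] at hq
    have h1 := hb g hg q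
    rw [← hq] at h1
    have h2 : (∑ j, starRingEnd ℂ (((α : ℂ) • q) j) * q j).re = α * ∑ j, ‖q j‖ ^ 2 := by
      have h3 : ∑ j, starRingEnd ℂ (((α : ℂ) • q) j) * q j = ((α * ∑ j, ‖q j‖ ^ 2 : ℝ) : ℂ) := by
        push_cast
        simp only [Fin.sum_univ_two, Pi.smul_apply, smul_eq_mul, map_mul, Complex.conj_ofReal,
          ← Complex.conj_mul']
        ring
      rw [h3, Complex.ofReal_re]
    rw [h2] at h1
    have h4 : ∑ j, ‖q j‖ ^ 2 = 0 := le_antisymm (by linarith) (by positivity)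
    rw [Finset.sum_eq_zero_iff_of_nonneg fun _ _ => by positivity] at h4
    funext j
    simpa using h4 j (Finset.mem_univ j)
  let K := LinearEquiv.ofInjectiveEndo Kmap hKinj
  have hKs : ∀ b, Kmap (K.symm b) = b := fun b => K.apply_symm_apply b
  let U : L2 a →ₗ[ℂ] chargeSpace a k :=
    V + g ∘ₗ (K.symm : (Fin 2 → ℂ) →ₗ[ℂ] (Fin 2 → ℂ)) ∘ₗ bdry a ha k ∘ₗ V
  have hU : ∀ f, U f = V f + g (K.symm (bdry a ha k (V f))) := fun f => rfl
  have hUbdry : ∀ f, IsBdry a ha k α (U f) := by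
    intro f
    refine ⟨fun h => absurd h WithTop.coe_ne_top, fun b h => ?_⟩
    rw [← WithTop.coe_injective h, hU, map_add, map_add, hVcharge, hg.charge_eq, zero_add]
    have h1 := hKs (bdry a ha k (V f))
    rw [hK] at h1
    rw [← sub_eq_iff_eq_add.1 h1]
  have hUeta : ∀ f, eta a k (U f) = f - (c : ℂ) • psi a k (U f) := by
    intro f
    rw [hU, map_add, map_add, hg.eta_eq, hVeta, hVpsi, smul_add, neg_smul]
    abel
  let S : (Fin 2 → ℂ) →L[ℂ] L2 a :=
    LinearMap.toContinuousLinearMap (psi a k ∘ₗ g ∘ₗ (K.symm : (Fin 2 → ℂ) →ₗ[ℂ] (Fin 2 → ℂ)))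
  let B : L2 a →L[ℂ] (Fin 2 → ℂ) :=
    ContinuousLinearMap.pi fun j => innerSL ℂ (psi a k (g (Pi.single j 1)))
  let T : L2 a →L[ℂ] L2 a := R + S.comp B
  have hTU : ∀ f, T f = psi a k (U f) := by
    intro f
    have h1 : B f = bdry a ha k (V f) := by
      funext j
      exact (hVbdry f j).symm
    change R f + S (B f) = _
    rw [h1, hU, map_add, hVpsi]
    rfl
  have hTcompact : IsCompactOperator T :=
    hRc.add ((isCompactOperator_of_locallyCompactSpace_rng S).comp_clm B)
  have hTsymm : (T : L2 a →ₗ[ℂ] L2 a).IsSymmetric := by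
    intro f f'
    change inner ℂ (T f) f' = inner ℂ f (T f')
    have h1 := (hUbdry f).form_eq (hUbdry f').mem_formDomain
    rw [form_symm, (hUbdry f').form_eq (hUbdry f).mem_formDomain, inner_conj_symm, hUeta, hUeta,
      inner_sub_left, inner_sub_right, inner_smul_left, inner_smul_right,
      Complex.conj_ofReal] at h1
    rw [hTU, hTU]
    exact sub_left_inj.1 h1
  have hTinj : Function.Injective T := by
    rw [injective_iff_map_eq_zero]
    intro f hf
    rw [hTU] at hf
    have h1 := hUeta f
    rw [hf, eq_zero_of_psi_eq_zero a ha k hf, map_zero, smul_zero, sub_zero] at h1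
    exact h1.symm
  obtain ⟨ι, e, τ, he⟩ := exists_hilbertBasis_of_isCompactOperator hTcompact hTsymm hTinj
  have hpsi : ∀ i, psi a k (((τ i : ℂ)⁻¹) • U (e i)) = e i := by
    intro i
    rw [map_smul, ← hTU, (he i).1, inv_smul_smul₀ (Complex.ofReal_ne_zero.2 (he i).2)]
  refine ⟨ι, e, fun i => ((τ i : ℂ)⁻¹) • U (e i), fun i => (τ i)⁻¹ - c, fun i => ?_, hpsi,
    fun i => ?_⟩
  · refine ⟨fun h => absurd h WithTop.coe_ne_top, fun b h => ?_⟩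
    rw [map_smul, map_smul, (hUbdry (e i)).2 b h, smul_comm]
  · have h1 := hpsi i
    rw [map_smul] at h1
    rw [map_smul, hUeta, smul_sub, smul_comm, h1]
    push_cast
    rw [sub_smul]

/-! ### Sorted eigenbases -/

theorem exists_hilbertBasis_comp {H : Type*} [NormedAddCommGroup H] [InnerProductSpace ℂ H]
    [CompleteSpace H] {ι κ : Type*} (e : HilbertBasis ι ℂ H) (σ : κ ≃ ι) :
    ∃ e' : HilbertBasis κ ℂ H, ∀ i, e' i = e (σ i) := by
  refine ⟨HilbertBasis.mk (e.orthonormal.comp σ σ.injective) ?_, fun i =>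
    congrFun (HilbertBasis.coe_mk _ _) i⟩
  rw [σ.surjective.range_comp, e.dense_span]

theorem IsEigenbasis.exists_sorted {a : ℝ} {ha : 0 < a} {k : Plane} {α : WithTop ℝ} {ι : Type*}
    [Infinite ι] {e : HilbertBasis ι ℂ (L2 a)} {u : ι → chargeSpace a k} {l : ι → ℝ}
    (h : IsEigenbasis a ha k α e u l) (hl : ∀ μ, {i | l i ≤ μ}.Finite) :
    ∃ (e : HilbertBasis ℕ ℂ (L2 a)) (u : ℕ → chargeSpace a k) (l : ℕ → ℝ),
      IsEigenbasis a ha k α e u l ∧ Monotone l ∧ ∀ μ, {i | l i ≤ μ}.Finite := by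
  obtain ⟨σ, hσ⟩ := exists_equiv_nat_monotone l hl
  obtain ⟨e', he'⟩ := exists_hilbertBasis_comp e σ
  refine ⟨e', u ∘ σ, l ∘ σ, ⟨fun i => h.bdry _, fun i => ?_, fun i => ?_⟩, hσ, fun μ => ?_⟩
  · rw [he']
    exact h.psi _
  · rw [he']
    exact h.eta _
  · exact (hl μ).preimage σ.injective.injOn

theorem exists_sorted_top (a : ℝ) (ha : 0 < a) (k : Plane) :
    ∃ (e : HilbertBasis ℕ ℂ (L2 a)) (u : ℕ → chargeSpace a k) (l : ℕ → ℝ),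
      IsEigenbasis a ha k ⊤ e u l ∧ Monotone l ∧ ∀ μ, {i | l i ≤ μ}.Finite := by
  obtain ⟨u, hu⟩ := exists_isEigenbasis_top a ha k
  refine hu.exists_sorted fun μ => (finite_dual_ball a ha k √μ).subset fun m hm => ?_
  exact Real.le_sqrt_of_sq_le hm

theorem finrank_le_inf_ker {W : Type*} [AddCommGroup W] [Module ℂ W] (T : W →ₗ[ℂ] (Fin 2 → ℂ))
    (V : Submodule ℂ W) [FiniteDimensional ℂ V] : Module.finrank ℂ V ≤
      Module.finrank ℂ (V ⊓ LinearMap.ker T : Submodule ℂ W) + 2 := by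
  have h1 := LinearMap.finrank_range_add_finrank_ker (T.domRestrict V)
  have h2 : Module.finrank ℂ (LinearMap.range (T.domRestrict V)) ≤ 2 :=
    (Submodule.finrank_le _).trans (by simp)
  have h3 : Module.finrank ℂ (LinearMap.ker (T.domRestrict V)) =
      Module.finrank ℂ (V ⊓ LinearMap.ker T : Submodule ℂ W) := by
    rw [← Submodule.finrank_map_subtype_eq V (LinearMap.ker (T.domRestrict V)),
      LinearMap.ker_domRestrict, Submodule.map_comap_subtype]
  omega

/-- Two more eigenvalues below `s` with scatterers than without them. -/
theorem IsEigenbasis.le_of_card {a : ℝ} {ha : 0 < a} {k : Plane}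
    {e₀ : HilbertBasis ℕ ℂ (L2 a)} {u₀ : ℕ → chargeSpace a k} {l₀ : ℕ → ℝ}
    (h₀ : IsEigenbasis a ha k ⊤ e₀ u₀ l₀) (hl₀ : Monotone l₀) {α : WithTop ℝ} {ι : Type*}
    {e : HilbertBasis ι ℂ (L2 a)} {u : ι → chargeSpace a k} {l : ι → ℝ}
    (h : IsEigenbasis a ha k α e u l) {F : Finset ι} {s : ℝ} (hF : ∀ i ∈ F, l i ≤ s) {j : ℕ}
    (hj : j + 2 < F.card) : l₀ j ≤ s := by
  obtain ⟨c, hc⟩ := exists_form_nonneg a ha k 0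
  have hfd : FiniteDimensional ℂ (Submodule.span ℂ (u '' F)) :=
    FiniteDimensional.span_of_finite ℂ (F.finite_toSet.image u)
  have h1 := finrank_le_inf_ker (charge a k) (Submodule.span ℂ (u '' F))
  rw [h.formBasis.finrank_span] at h1
  refine h₀.formBasis.le_of_finrank_lt hl₀ (form_symm a ha k _) (c := c) hc
    (V := Submodule.span ℂ (u '' F) ⊓ LinearMap.ker (charge a k))
    (fun v hv => mem_formDomain_of_charge_eq_zero hv.2) (by omega)
    (fun v _ => eq_zero_of_psi_eq_zero a ha k) fun v hv => ?_
  have h2 := h.formBasis.re_form_le hF hv.1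
  rw [re_form_sub a ha k _ (α.untopD 0), LinearMap.mem_ker.1 hv.2]
  simpa using h2

theorem infinite_of_hilbertBasis (a : ℝ) (ha : 0 < a) {ι : Type*} (e : HilbertBasis ι ℂ (L2 a)) :
    Infinite ι := by
  by_contra hfin
  rw [not_infinite_iff_finite] at hfin
  have := Fintype.ofFinite ι
  have hfd : Module.Finite ℂ (L2 a) := Module.Finite.of_basis e.toOrthonormalBasis.toBasis
  have h1 := (waveBasis a ha 0).orthonormal.linearIndependent
  have h2 : Finite (Fin 2 → ℤ) := h1.finite
  exact not_finite (Fin 2 → ℤ)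

theorem exists_sorted (a : ℝ) (ha : 0 < a) (k : Plane) (α : WithTop ℝ) :
    ∃ (e : HilbertBasis ℕ ℂ (L2 a)) (u : ℕ → chargeSpace a k) (l : ℕ → ℝ),
      IsEigenbasis a ha k α e u l ∧ Monotone l ∧ ∀ μ, {i | l i ≤ μ}.Finite := by
  obtain ⟨e₀, u₀, l₀, h₀, hl₀, hf₀⟩ := exists_sorted_top a ha k
  induction α using WithTop.recTopCoe with
  | top => exact ⟨e₀, u₀, l₀, h₀, hl₀, hf₀⟩
  | coe α =>
    obtain ⟨ι, e, u, l, h⟩ := exists_isEigenbasis_coe a ha k α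
    have := infinite_of_hilbertBasis a ha e
    refine h.exists_sorted fun μ => ?_
    by_contra hinf
    obtain ⟨j, hj⟩ := (hf₀ μ).exists_notMem
    obtain ⟨F, hF, hFc⟩ := Set.Infinite.exists_subset_card_eq hinf (j + 3)
    exact hj (h₀.le_of_card hl₀ h (fun i hi => hF hi) (by omega))

theorem IsEigenbasis.isEigenvalueSequence {a : ℝ} {ha : 0 < a} {k : Plane} {α : WithTop ℝ}
    {e : HilbertBasis ℕ ℂ (L2 a)} {u : ℕ → chargeSpace a k} {l : ℕ → ℝ}
    (h : IsEigenbasis a ha k α e u l) (hl : Monotone l) (hf : ∀ μ, {i | l i ≤ μ}.Finite) :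
    IsEigenvalueSequence (pointScatterer a ha k (fun _ => α)) l :=
  isEigenvalueSequence_of_hilbertBasis (pointScatterer_symm a ha k α) e hl hf h.mem_graph

theorem IsEigenvalueSequence.exists_isEigenbasis {a : ℝ} {ha : 0 < a} {k : Plane}
    {α : WithTop ℝ} {l : ℕ → ℝ}
    (h : IsEigenvalueSequence (pointScatterer a ha k (fun _ => α)) l) :
    ∃ (e : HilbertBasis ℕ ℂ (L2 a)) (u : ℕ → chargeSpace a k), IsEigenbasis a ha k α e u l := by
  obtain ⟨e, u, l', h', hl', hf'⟩ := exists_sorted a ha k α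
  rw [h.unique (h'.isEigenvalueSequence hl' hf')]
  exact ⟨e, u, h'⟩

/-! ### Dependence of the eigenvalues on the parameter -/

/-- The quadratic form with parameter `α`, shifted by `c`. -/
def energy (a : ℝ) (ha : 0 < a) (k : Plane) (c α : ℝ) (u : chargeSpace a k) : ℝ :=
  (form a ha k α u u).re + c * ‖psi a k u‖ ^ 2

theorem energy_of_charge_eq_zero {a : ℝ} {ha : 0 < a} {k : Plane} {u : chargeSpace a k}
    (hu : charge a k u = 0) (c α α' : ℝ) : energy a ha k c α u = energy a ha k c α' u := by
  rw [energy, energy, re_form_sub a ha k α α', hu]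
  simp

theorem energy_nonneg_of_charge_eq_zero {a : ℝ} {ha : 0 < a} {k : Plane} {u : chargeSpace a k}
    (hu : charge a k u = 0) {c : ℝ} (hc : 0 ≤ c) (α : ℝ) : 0 ≤ energy a ha k c α u :=
  add_nonneg (form_nonneg_of_charge_eq_zero a ha k α hu) (by positivity)

section

variable {a : ℝ} {ha : 0 < a} {k : Plane} {α : WithTop ℝ} {e : HilbertBasis ℕ ℂ (L2 a)}
  {u : ℕ → chargeSpace a k} {l : ℕ → ℝ}

theorem IsEigenbasis.le_of_energy_le (h : IsEigenbasis a ha k α e u l) (hl : Monotone l)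
    {V : Submodule ℂ (chargeSpace a k)} (hV : V ≤ formDomain a k α) {j : ℕ}
    (hj : j < Module.finrank ℂ V) {c s : ℝ}
    (hs : ∀ v ∈ V, energy a ha k c (α.untopD 0) v ≤ (s + c) * ‖PointScatterer.psi a k v‖ ^ 2) :
    l j ≤ s := by
  obtain ⟨b, hb⟩ := exists_form_nonneg a ha k (α.untopD 0)
  refine h.formBasis.le_of_finrank_lt hl (form_symm a ha k _) hb hV hj
    (fun v _ => eq_zero_of_psi_eq_zero a ha k) fun v hv => ?_
  have h1 := hs v hv
  rw [energy, add_mul] at h1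
  linarith

theorem IsEigenbasis.energy_le (h : IsEigenbasis a ha k α e u l) (hl : Monotone l) (j : ℕ)
    {v : chargeSpace a k} (hv : v ∈ Submodule.span ℂ (u '' (Finset.range (j + 1)))) (c : ℝ) :
    energy a ha k c (α.untopD 0) v ≤ (l j + c) * ‖PointScatterer.psi a k v‖ ^ 2 := by
  rw [energy, add_mul]
  gcongr
  exact h.formBasis.re_form_le
    (fun i hi => hl (Nat.lt_succ_iff.1 (Finset.mem_range.1 hi))) hv

theorem IsEigenbasis.energy_self (h : IsEigenbasis a ha k α e u l) (j : ℕ) (c : ℝ) :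
    energy a ha k c (α.untopD 0) (u j) = l j + c := by
  rw [energy, h.formBasis.form j _ (h.formBasis.mem j), h.psi, inner_self_eq_norm_sq_to_K,
    e.orthonormal.1 j]
  simp

theorem IsEigenbasis.mono (h : IsEigenbasis a ha k α e u l) (hl : Monotone l) {α' : WithTop ℝ}
    {e' : HilbertBasis ℕ ℂ (L2 a)} {u' : ℕ → chargeSpace a k} {l' : ℕ → ℝ}
    (h' : IsEigenbasis a ha k α' e' u' l') (hl' : Monotone l') (hα : α ≤ α') (j : ℕ) :
    l j ≤ l' j := by
  have hle := h'.formBasis.span_le (Finset.range (j + 1))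
  refine h.le_of_energy_le hl (c := 0) (hle.trans fun v hv hα' => ?_)
    (by rw [h'.formBasis.finrank_span]; simp) fun v hv => ?_
  · exact hv (top_le_iff.1 (hα' ▸ hα))
  refine le_trans ?_ (h'.energy_le hl' j hv 0)
  have hv' := hle hv
  induction α' using WithTop.recTopCoe with
  | top => exact (energy_of_charge_eq_zero (hv' rfl) _ _ _).le
  | coe b' =>
    induction α using WithTop.recTopCoe with
    | top => exact absurd (top_le_iff.1 hα) WithTop.coe_ne_top
    | coe b =>
      have hb : b ≤ b' := WithTop.coe_le_coe.1 hα
      have h1 : 0 ≤ (b' - b) * ∑ j, ‖charge a k v j‖ ^ 2 :=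
        mul_nonneg (sub_nonneg.2 hb) (by positivity)
      rw [WithTop.untopD_coe, WithTop.untopD_coe, energy, energy, re_form_sub a ha k b b']
      linarith

theorem IsEigenbasis.nonneg (h : IsEigenbasis a ha k ⊤ e u l) (j : ℕ) : 0 ≤ l j := by
  have h1 := energy_nonneg_of_charge_eq_zero (ha := ha) ((h.bdry j).1 rfl) le_rfl 0
  have h2 := h.energy_self j 0
  rw [WithTop.untopD_top] at h2
  linarith

theorem IsEigenbasis.interlace {e₀ : HilbertBasis ℕ ℂ (L2 a)} {u₀ : ℕ → chargeSpace a k}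
    {l₀ : ℕ → ℝ} (h₀ : IsEigenbasis a ha k ⊤ e₀ u₀ l₀) (hl₀ : Monotone l₀)
    (h : IsEigenbasis a ha k α e u l) (hl : Monotone l) (j : ℕ) : l₀ j ≤ l (j + 2) :=
  h₀.le_of_card hl₀ h (F := Finset.range (j + 3))
    (fun i hi => hl (Nat.lt_succ_iff.1 (Finset.mem_range.1 hi))) (by simp)

end

theorem exists_isGreenMap_energy (a : ℝ) (ha : 0 < a) (k : Plane) {c : ℝ} (hc : 1 ≤ c) :
    ∃ g K, IsGreenMap a k c g ∧ 0 ≤ K ∧ (∀ q, ‖psi a k (g q)‖ ^ 2 ≤ K * ∑ j, ‖q j‖ ^ 2) ∧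
      ∀ α v q, charge a k v = 0 → |energy a ha k c α (v + g q) -
        (energy a ha k c 0 v + α * ∑ j, ‖q j‖ ^ 2)| ≤ K * ∑ j, ‖q j‖ ^ 2 := by
  obtain ⟨g, hg⟩ := exists_isGreenMap a ha k hc
  obtain ⟨K₁, h1, hK₁⟩ := exists_norm_sq_le (psi a k ∘ₗ g)
  obtain ⟨K₂, h2, hK₂⟩ := exists_norm_quadratic_le (bdry a ha k ∘ₗ g)
  refine ⟨g, max K₁ K₂, hg, h1.trans (le_max_left _ _), fun q => (hK₁ q).trans ?_,
    fun α v q hv => ?_⟩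
  · gcongr
    exact le_max_left _ _
  · have h3 : energy a ha k c α (v + g q) - (energy a ha k c 0 v + α * ∑ j, ‖q j‖ ^ 2) =
        -(∑ j, starRingEnd ℂ (bdry a ha k (g q) j) * q j).re := by
      rw [energy, hg.re_form_add α hv q, ← energy, energy_of_charge_eq_zero hv c α 0]
      ring
    rw [h3, abs_neg]
    refine (Complex.abs_re_le_norm _).trans ((hK₂ q).trans ?_)
    gcongr
    exact le_max_right _ _

theorem norm_add_sq_le_of_pos {E : Type*} [SeminormedAddCommGroup E] (x y : E) {δ : ℝ}
    (hδ : 0 < δ) : ‖x + y‖ ^ 2 ≤ (1 + δ) * ‖x‖ ^ 2 + (1 + δ⁻¹) * ‖y‖ ^ 2 := by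
  have h1 := pow_le_pow_left₀ (norm_nonneg _) (norm_add_le x y) 2
  have h2 : 0 ≤ δ⁻¹ * (δ * ‖x‖ - ‖y‖) ^ 2 := by positivity
  have h3 : δ⁻¹ * (δ * ‖x‖ - ‖y‖) ^ 2 = δ * ‖x‖ ^ 2 - 2 * (‖x‖ * ‖y‖) + δ⁻¹ * ‖y‖ ^ 2 := by
    field_simp
    ring
  nlinarith

theorem eventually_le_neg (a : ℝ) (ha : 0 < a) (k : Plane) {j : ℕ} (hj : j < 2) {c : ℝ}
    (hc : 1 ≤ c) : ∀ᶠ α : ℝ in atBot, ∀ (e : HilbertBasis ℕ ℂ (L2 a)) (u : ℕ → chargeSpace a k)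
      (l : ℕ → ℝ), IsEigenbasis a ha k α e u l → Monotone l → l j ≤ -c := by
  obtain ⟨g, K, hg, hK, -, hE⟩ := exists_isGreenMap_energy a ha k hc
  filter_upwards [eventually_le_atBot (-K)] with α hα e u l h hl
  have hinj : Function.Injective g := Function.LeftInverse.injective hg.charge_eq
  refine h.le_of_energy_le hl (V := LinearMap.range g) (c := c) (fun v _ => mem_formDomain_coe v)
    (by rw [LinearMap.finrank_range_of_inj hinj]; simpa using hj) ?_
  rintro _ ⟨q, rfl⟩
  have h1 := (abs_le.1 (hE α 0 q (map_zero _))).2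
  have h2 : energy a ha k c 0 (0 : chargeSpace a k) = 0 := by simp [energy]
  have h3 : (α + K) * ∑ j, ‖q j‖ ^ 2 ≤ 0 :=
    mul_nonpos_of_nonpos_of_nonneg (by linarith) (by positivity)
  rw [zero_add, h2] at h1
  rw [WithTop.untopD_coe, neg_add_cancel, zero_mul]
  linarith

theorem eventually_le_add_of_atTop {a : ℝ} {ha : 0 < a} {k : Plane}
    {e₀ : HilbertBasis ℕ ℂ (L2 a)} {u₀ : ℕ → chargeSpace a k} {l₀ : ℕ → ℝ}
    (h₀ : IsEigenbasis a ha k ⊤ e₀ u₀ l₀) (hl₀ : Monotone l₀) (j : ℕ) {ε : ℝ} (hε : 0 < ε) :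
    ∀ᶠ α : ℝ in atTop, ∀ (e : HilbertBasis ℕ ℂ (L2 a)) (u : ℕ → chargeSpace a k)
      (l : ℕ → ℝ), IsEigenbasis a ha k α e u l → Monotone l → l₀ j ≤ l j + ε := by
  obtain ⟨g, K, hg, hK, hpsi, hE⟩ := exists_isGreenMap_energy a ha k le_rfl
  have hL : 0 < l₀ j + 1 := by linarith [h₀.nonneg j]
  set δ := ε / (l₀ j + 1) with hδ
  have hδ0 : 0 < δ := by positivity
  have hδL : δ * (l₀ j + 1) = ε := div_mul_cancel₀ _ hL.ne'
  filter_upwards [eventually_gt_atTop (K + (l₀ j + 1) * ((1 + δ⁻¹) * K))] with α hα e u l h hl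
  have hle : l j ≤ l₀ j := h.mono hl h₀ hl₀ le_top j
  have hαK : 0 < α - K := by
    have : 0 ≤ (l₀ j + 1) * ((1 + δ⁻¹) * K) := by positivity
    linarith
  have hlow : ∀ w, energy a ha k 1 0 (w - g (charge a k w)) +
      (α - K) * ∑ i, ‖charge a k w i‖ ^ 2 ≤ energy a ha k 1 α w := by
    intro w
    have h1 := (abs_le.1 (hE α _ (charge a k w) (hg.charge_sub w))).1
    rw [sub_add_cancel] at h1
    linarith
  have hnn : ∀ w, 0 ≤ energy a ha k 1 0 (w - g (charge a k w)) := fun w =>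
    energy_nonneg_of_charge_eq_zero (hg.charge_sub w) zero_le_one 0
  have hpos : 0 ≤ l j + 1 := by
    have h1 := hlow (u j)
    have h2 := h.energy_self j 1
    have h3 : 0 ≤ (α - K) * ∑ i, ‖charge a k (u j) i‖ ^ 2 := by positivity
    rw [WithTop.untopD_coe] at h2
    linarith [hnn (u j)]
  have hbound : ∀ w ∈ Submodule.span ℂ (u '' (Finset.range (j + 1))),
      energy a ha k 1 0 (w - g (charge a k w)) +
        (α - K - (l₀ j + 1) * ((1 + δ⁻¹) * K)) * ∑ i, ‖charge a k w i‖ ^ 2 ≤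
          (l j + 1) * (1 + δ) * ‖psi a k (w - g (charge a k w))‖ ^ 2 := by
    intro w hw
    have h1 := (hlow w).trans (h.energy_le hl j hw 1)
    have h2 := norm_add_sq_le_of_pos (psi a k (w - g (charge a k w)))
      (psi a k (g (charge a k w))) hδ0
    rw [← map_add, sub_add_cancel] at h2
    have h3 := mul_le_mul_of_nonneg_left (h2.trans (add_le_add_right
      (mul_le_mul_of_nonneg_left (hpsi (charge a k w)) (by positivity)) _)) hpos
    have h4 : (l j + 1) * ((1 + δ⁻¹) * (K * ∑ i, ‖charge a k w i‖ ^ 2)) ≤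
        (l₀ j + 1) * ((1 + δ⁻¹) * (K * ∑ i, ‖charge a k w i‖ ^ 2)) := by gcongr
    linarith
  set V := Submodule.span ℂ (u '' (Finset.range (j + 1))) with hV
  let T : chargeSpace a k →ₗ[ℂ] chargeSpace a k := LinearMap.id - g ∘ₗ charge a k
  have hinj : Function.Injective (T.domRestrict V) := by
    rw [injective_iff_map_eq_zero]
    rintro ⟨w, hw⟩ hTw
    have hTw' : w - g (charge a k w) = 0 := hTw
    have h1 := hbound w hw
    have h2 := hnn w
    rw [hTw', map_zero, norm_zero, zero_pow two_ne_zero, mul_zero] at h1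
    rw [hTw'] at h2
    have h3 : ∑ i, ‖charge a k w i‖ ^ 2 = 0 := by
      refine le_antisymm (not_lt.1 fun h4 => ?_) (by positivity)
      have := mul_pos (show 0 < α - K - (l₀ j + 1) * ((1 + δ⁻¹) * K) by linarith) h4
      linarith
    rw [Finset.sum_eq_zero_iff_of_nonneg fun _ _ => by positivity] at h3
    have h5 : charge a k w = 0 := funext fun i => by simpa using h3 i (Finset.mem_univ i)
    rw [h5, map_zero, sub_zero] at hTw'
    exact Subtype.ext hTw'
  have hmain : l₀ j ≤ (l j + 1) * (1 + δ) - 1 := by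
    refine h₀.le_of_energy_le hl₀ (V := LinearMap.range (T.domRestrict V)) (c := 1) ?_ ?_ ?_
    · rintro _ ⟨w, rfl⟩
      exact mem_formDomain_of_charge_eq_zero (hg.charge_sub _)
    · rw [LinearMap.finrank_range_of_inj hinj, hV, h.formBasis.finrank_span]
      simp
    · rintro _ ⟨⟨w, hw⟩, rfl⟩
      rw [sub_add_cancel, WithTop.untopD_top]
      refine le_trans ?_ (hbound w hw)
      have : 0 ≤ (α - K - (l₀ j + 1) * ((1 + δ⁻¹) * K)) * ∑ i, ‖charge a k w i‖ ^ 2 :=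
        mul_nonneg (by linarith) (by positivity)
      change energy a ha k 1 0 (w - g (charge a k w)) ≤ _
      linarith
  nlinarith

theorem eventually_le_add_of_atBot {a : ℝ} {ha : 0 < a} {k : Plane}
    {e₀ : HilbertBasis ℕ ℂ (L2 a)} {u₀ : ℕ → chargeSpace a k} {l₀ : ℕ → ℝ}
    (h₀ : IsEigenbasis a ha k ⊤ e₀ u₀ l₀) (hl₀ : Monotone l₀) (j : ℕ) {ε : ℝ} (hε : 0 < ε) :
    ∀ᶠ α : ℝ in atBot, ∀ (e : HilbertBasis ℕ ℂ (L2 a)) (u : ℕ → chargeSpace a k)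
      (l : ℕ → ℝ), IsEigenbasis a ha k α e u l → Monotone l → l (j + 2) ≤ l₀ j + ε := by
  obtain ⟨g, K, hg, hK, hpsi, hE⟩ := exists_isGreenMap_energy a ha k le_rfl
  have hL : 0 < l₀ j + 1 := by linarith [h₀.nonneg j]
  set δ := ε / (l₀ j + 1) with hδ
  have hδ0 : 0 < δ := by positivity
  have hδL : δ * (l₀ j + 1) = ε := div_mul_cancel₀ _ hL.ne'
  filter_upwards [eventually_le_atBot (-(K + (l₀ j + 1) * ((1 + δ⁻¹) * K)))] with α hα e u l h hl
  set V := Submodule.span ℂ (u₀ '' (Finset.range (j + 1))) with hV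
  have hcharge : ∀ v ∈ V, charge a k v = 0 := fun v hv => h₀.formBasis.span_le _ hv rfl
  let T : V × (Fin 2 → ℂ) →ₗ[ℂ] chargeSpace a k := V.subtype.coprod g
  have hT : ∀ p, T p = p.1 + g p.2 := fun p => rfl
  have hinj : Function.Injective T := by
    rw [injective_iff_map_eq_zero]
    rintro ⟨⟨v, hv⟩, q⟩ h1
    rw [hT] at h1
    have h2 := congrArg (charge a k) h1
    rw [map_add, hcharge v hv, hg.charge_eq, map_zero, zero_add] at h2
    have h3 : q = 0 := h2
    subst h3
    rw [map_zero, add_zero] at h1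
    exact Prod.ext (Subtype.ext h1) rfl
  have hfd : FiniteDimensional ℂ V :=
    FiniteDimensional.span_of_finite ℂ ((Finset.range (j + 1)).finite_toSet.image u₀)
  have hfree : Module.Free ℂ V := Module.Free.of_divisionRing ℂ V
  refine h.le_of_energy_le hl (V := LinearMap.range T) (c := 1)
    (fun v _ => mem_formDomain_coe v) ?_ ?_
  · rw [LinearMap.finrank_range_of_inj hinj, Module.finrank_prod, hV,
      h₀.formBasis.finrank_span]
    simp
  · rintro _ ⟨⟨⟨v, hv⟩, q⟩, rfl⟩
    rw [hT, WithTop.untopD_coe]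
    change energy a ha k 1 α (v + g q) ≤ (l₀ j + ε + 1) * ‖psi a k (v + g q)‖ ^ 2
    have h1 := (abs_le.1 (hE α v q (hcharge v hv))).2
    have h2 : energy a ha k 1 0 v ≤ (l₀ j + 1) * ‖psi a k v‖ ^ 2 := h₀.energy_le hl₀ j hv 1
    have h3 := norm_add_sq_le_of_pos (psi a k (v + g q)) (-psi a k (g q)) hδ0
    rw [norm_neg, ← sub_eq_add_neg, ← map_sub, add_sub_cancel_right] at h3
    have h4 := mul_le_mul_of_nonneg_left (h3.trans (add_le_add_right
      (mul_le_mul_of_nonneg_left (hpsi q) (by positivity)) _)) hL.le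
    have h5 : (α + (K + (l₀ j + 1) * ((1 + δ⁻¹) * K))) * ∑ i, ‖q i‖ ^ 2 ≤ 0 :=
      mul_nonpos_of_nonpos_of_nonneg (by linarith) (by positivity)
    have h6 : (l₀ j + ε + 1) = (l₀ j + 1) * (1 + δ) := by linarith
    rw [h6]
    linarith

end PointScatterer

end

theorem mainTheorem9 (a : ℝ) (ha : 0 < a) (k : PointScatterer.Plane) :
    (∃ lamInf : ℕ → ℝ,
      PointScatterer.IsEigenvalueSequence (PointScatterer.floquetLaplacian a k) lamInf) ∧
    (∀ α : WithTop ℝ, ∃ lam : ℕ → ℝ,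
      PointScatterer.IsEigenvalueSequence
        (PointScatterer.pointScatterer a ha k (fun _ => α)) lam) ∧
    ∀ (lamInf : ℕ → ℝ) (lam : WithTop ℝ → ℕ → ℝ),
      PointScatterer.IsEigenvalueSequence (PointScatterer.floquetLaplacian a k) lamInf →
      (∀ α : WithTop ℝ, PointScatterer.IsEigenvalueSequence
        (PointScatterer.pointScatterer a ha k (fun _ => α)) (lam α)) →
      (∀ j : ℕ, Monotone (fun α : WithTop ℝ => lam α j)) ∧
      0 ≤ lamInf 0 ∧
      (∀ (α : WithTop ℝ) (j : ℕ), 2 ≤ j → lamInf 0 ≤ lam α j) ∧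
      (∀ j : ℕ, j < 2 → Tendsto (fun α : ℝ => lam (α : WithTop ℝ) j) atBot atBot) ∧
      (∀ j : ℕ,
        Tendsto (fun α : ℝ => lam (α : WithTop ℝ) j) atTop (𝓝 (lamInf j)) ∧
        Tendsto (fun α : ℝ => lam (α : WithTop ℝ) (j + 2)) atBot (𝓝 (lamInf j))) := by
  have hex : ∀ α : WithTop ℝ, ∃ lam : ℕ → ℝ, PointScatterer.IsEigenvalueSequence
      (PointScatterer.pointScatterer a ha k (fun _ => α)) lam := by
    intro α
    obtain ⟨e, u, l, h, hl, hf⟩ := PointScatterer.exists_sorted a ha k α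
    exact ⟨l, h.isEigenvalueSequence hl hf⟩
  refine ⟨PointScatterer.floquetLaplacian_eq a ha k ▸ hex ⊤, hex, fun lamInf lam hInf hlam => ?_⟩
  rw [PointScatterer.floquetLaplacian_eq a ha k] at hInf
  obtain ⟨e₀, u₀, h₀⟩ := hInf.exists_isEigenbasis
  have hbasis := fun α => (hlam α).exists_isEigenbasis
  choose e u h using hbasis
  have hl := fun α => (hlam α).1
  refine ⟨fun j α α' hα => (h α).mono (hl α) (h α') (hl α') hα j, h₀.nonneg 0,
    fun α j hj => ?_, fun j hj => tendsto_atBot.2 fun M => ?_, fun j => ⟨?_, ?_⟩⟩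
  · obtain ⟨i, rfl⟩ := Nat.exists_eq_add_of_le' hj
    exact (hInf.1 (Nat.zero_le i)).trans (h₀.interlace hInf.1 (h α) (hl α) i)
  · filter_upwards [PointScatterer.eventually_le_neg a ha k hj (le_max_left 1 (-M))] with α hα
    exact (hα _ _ _ (h α) (hl α)).trans (by linarith [le_max_right 1 (-M)])
  · refine tendsto_order.2 ⟨fun x hx => ?_, fun x hx => Eventually.of_forall fun α =>
      ((h α).mono (hl α) h₀ hInf.1 le_top j).trans_lt hx⟩
    filter_upwards [PointScatterer.eventually_le_add_of_atTop h₀ hInf.1 j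
      (half_pos (sub_pos.2 hx))] with α hα
    linarith [hα _ _ _ (h α) (hl α)]
  · refine tendsto_order.2 ⟨fun x hx => Eventually.of_forall fun α =>
      hx.trans_le (h₀.interlace hInf.1 (h α) (hl α) j), fun x hx => ?_⟩
    filter_upwards [PointScatterer.eventually_le_add_of_atBot h₀ hInf.1 j
      (half_pos (sub_pos.2 hx))] with α hα
    linarith [hα _ _ _ (h α) (hl α)]
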